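/- **Setting.** All systems are finite-dimensional, and the order in which the subsystems of a composite system are listed is irrelevant. For each system a set of free states is given, and a set $\mathfrak U_F$ of free unitaries, which act on composite systems. Let $M$ be a real function of states such that: (i) $M$ does not increase when a free state is added, when $\mathrm{id}\otimes\mathcal U$ or $\mathrm{id}\otimes\mathcal U^\dagger$ with a free unitary $\mathcal U$ is applied, or under a partial trace; (ii) $M(\rho\otimes\sigma)=M(\rho)+M(\sigma)$; (iii) there are a real function $c$ with $\lim_{x\to0}c(x)=0$ and $c\le c_{\max}$ and, for each system $S$, constants $K_S\ge 0$, $0<a_S\le\infty$, $0<b_S<\infty$ with $a_S+b_S>1$ such that, for all $m\ge 1$, all states $\rho$ on $S$ and all states $\sigma_m$ on $m$ copies of $S$, with $\epsilon_m=\|\rho^{\otimes m}-\sigma_m\|_1$, $$|M(\rho^{\otimes m})-M(\sigma_m)|\le m^{a_S}K_S\,\epsilon_m^{b_S}+c(\epsilon_m),$$ where for $a_S=\infty$ the factor $m^{a_S}$ is replaced by $e^{a'_Sm}$ with a real number $a'_S$ such that $a'_S+b_S>0$. **Quantities.** For a channel $\Gamma$ let $M_\rho(\Gamma)=M(\Gamma(\rho))-M(\rho)$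 and $M(\Gamma)=\sup_{R,\sigma}M_\sigma(\mathrm{id}_R\otimes\Gamma)$. With $F(\rho,\sigma)=\mathrm{Tr}\sqrt{\sqrt\rho\,\sigma\sqrt\rho}$ let $D_F(\rho,\sigma)=\sqrt{1-F(\rho,\sigma)^2}$, and for channels let $D_F(\Lambda_1,\Lambda_2)$ be the supremum of $D_F(\mathrm{id}\otimes\Lambda_1(\rho),\mathrm{id}\otimes\Lambda_2(\rho))$ over references and states $\rho$. For a channel $\Lambda$ from $A$ to $A'$, $M_c^\epsilon(\Lambda)\in(-\infty,\infty]$ is the infimum of $M(\eta)$ over all states $\eta$ on ancillas $B$ for which some free unitary $U$ on $AB=A'B'$ satisfies $D_F\bigl(\Lambda,\mathrm{Tr}_{B'}[U(\cdot\otimes\eta)U^\dagger]\bigr)\le\epsilon$ (and $\infty$ if there is none); $M_c=M_c^0$. Let $\Omega_p=(\rho_1,\rho_2)_p$ be states on $A$ with $F(\rho_1,\rho_2)=0$ and prior probabilities $p_1=p$, $p_2=1-p$, $p\in[0,1]$. Put $\Omega'_{p,\Lambda}=(\Lambda(\rho_1),\Lambda(\rho_2))_p$ and $$\delta(\Lambda,\Omega_p)^2=\min_{\mathcal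 R}\sum_kp_kD_F(\rho_k,\mathcal R\circ\Lambda(\rho_k))^2$$ over channels $\mathcal R$ from $A'$ to $A$. Let $\mathscr K$ be a two-level system $K$ with an orthonormal basis $\{|k\rangle\}_{k=1,2}$. $M_{\mathrm{em}}(\Omega_p|\mathscr K)$ is the maximum of $M_\rho(\Lambda_{\mathbb P})$, $\Lambda_{\mathbb P}(\cdot)=\sum_kP_k\cdot P_k\otimes|k\rangle\langle k|_K$, over states $\rho$ on $A$ and two-valued PVMs $\mathbb P$ with $\mathrm{Tr}[P_k\rho_k]=1$ and $\Lambda_{\mathbb P}(\rho)=\sum_kp_k\rho_k\otimes|k\rangle\langle k|_K$. $M_{\cos}(\Omega'_{p,\Lambda}|\mathscr K)$ is the minimum of $M(\Lambda_{\mathbb Q})$, $\Lambda_{\mathbb Q}(\cdot)=\sum_k\sqrt{Q_k}\cdot\sqrt{Q_k}\otimes|k\rangle\langle k|_K$, over the two-valued POVMs $\mathbb Q$ on $A'$ that minimize the failure probability $\sum_kp_k\mathrm{Tr}[(1-Q_k)\Lambda(\rho_k)]$. Write $$G=|M_{\mathrm{em}}(\Omega_p|\mathscr K)-M_{\cos}(\Omega'_{p,\Lambda}|\mathscr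 K)|_+,\qquad |x|_+=\max(x,0),\qquad f(x)=4x+x^2,\qquad \delta=\delta(\Lambda,\Omega_p),$$ and let $K,a,b,a'$ be the constants of (iii) for the composite system $S=AK$ of $A$ and the register. **Theorem.** For every such $M$, every channel $\Lambda$ from $A$ to $A'$, every such $\Omega_p$ and every $\mathscr K$: 1. If $a<\infty$, then with $g(a,b)=\left(\frac1{a+b}\right)^{\frac1{a+b-1}}\left(1-\frac1{a+b}\right)$, $$M_c(\Lambda)\ \ge\ g(a,b)\,\frac{G^{\frac{a+b}{a+b-1}}}{\bigl(K f(\delta)^{b}\bigr)^{\frac1{a+b-1}}}-G-c_{\max}.$$ 2. If $a=\infty$, then $$M_c(\Lambda)\ \ge\ \frac{G}{a'+b}\log\frac{G}{K f(\delta)^{b}(a'+b)}-G\Bigl(1+\frac1{a'+b}\Bigr)-c_{\max}.$$ 3. If $a=b=1$ and $K>0$, then $$M_c(\Lambda)\ \ge\ \frac{G^2}{16K\delta}-c',\qquad c'=c_{\max}+G+\frac{G^2}{64K}.$$ 4. If $G>0$ and $\delta=0$, then $M_c(\Lambda)=\infty$, and for every $\epsilon\ge0$ the bounds in 1, 2 and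 3 hold with $M_c(\Lambda)$ replaced by $M_c^\epsilon(\Lambda)$ and $\delta$ replaced by $\epsilon$. In particular, for $a=b=1$ the cost grows at least like $1/\epsilon$. Here $x/0=\infty$ for $x>0$, $0/0=0$, $\log\infty=\infty$ and $0\log0=0$. -/

import Mathlib

open scoped ENNReal Topology Kronecker ComplexOrder MatrixOrder

noncomputable section

universe u

/-! ### Quantum systems -/

/-- Finite-dimensional quantum systems.  Elementary systems are labelled by an arbitrary type `E`
(a label may carry any extra data, such as a Hamiltonian); `d e` is the dimension of the elementary
system `e`.  Systems are built from the trivial system and elementary systems by composition. -/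
inductive Sys {E : Type u} (d : E → ℕ+) : Type u
  | unit : Sys d
  | atom (e : E) : Sys d
  | tensor (S T : Sys d) : Sys d

/-- `S ⊠ T` is the composite system `ST`. -/
infixr:70 " ⊠ " => Sys.tensor

namespace Sys

variable {E : Type u} {d : E → ℕ+}

/-- Index set of the product basis of the Hilbert space `ℂ ^ S.idx` of `S`. -/
@[reducible] def idx : Sys d → Type
  | unit => Unit
  | atom e => Fin (d e : ℕ)
  | tensor S T => S.idx × T.idx

instance instFintypeIdx : ∀ S : Sys d, Fintype S.idx
  | unit => inferInstanceAs (Fintype Unit)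
  | atom e => inferInstanceAs (Fintype (Fin (d e : ℕ)))
  | tensor S T =>
    letI := instFintypeIdx S
    letI := instFintypeIdx T
    inferInstanceAs (Fintype (S.idx × T.idx))

instance instDecidableEqIdx : ∀ S : Sys d, DecidableEq S.idx
  | unit => inferInstanceAs (DecidableEq Unit)
  | atom e => inferInstanceAs (DecidableEq (Fin (d e : ℕ)))
  | tensor S T =>
    letI := instDecidableEqIdx S
    letI := instDecidableEqIdx T
    inferInstanceAs (DecidableEq (S.idx × T.idx))

/-- `m` copies `S₁ ⋯ Sₘ` of the system `S`. -/
def copies (S : Sys d) : ℕ → Sys d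
  | 0 => unit
  | m + 1 => S.copies m ⊠ S

/-- Relabelings of product bases that only reorder or rebracket the subsystems of a composite
system, or insert or delete trivial subsystems. -/
inductive Rearrangement : ∀ {S T : Sys d}, (S.idx ≃ T.idx) → Prop
  | refl (S : Sys d) : Rearrangement (Equiv.refl S.idx)
  | symm {S T : Sys d} {e : S.idx ≃ T.idx} : Rearrangement e → Rearrangement e.symm
  | trans {S T U : Sys d} {e : S.idx ≃ T.idx} {f : T.idx ≃ U.idx} :
      Rearrangement e → Rearrangement f → Rearrangement (e.trans f)
  | congr {S S' T T' : Sys d} {e : S.idx ≃ S'.idx} {f : T.idx ≃ T'.idx} :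
      Rearrangement e → Rearrangement f →
        Rearrangement (S := S ⊠ T) (T := S' ⊠ T') (e.prodCongr f)
  | comm (S T : Sys d) :
      Rearrangement (S := S ⊠ T) (T := T ⊠ S) (Equiv.prodComm S.idx T.idx)
  | assoc (S T U : Sys d) :
      Rearrangement (S := (S ⊠ T) ⊠ U) (T := S ⊠ (T ⊠ U)) (Equiv.prodAssoc S.idx T.idx U.idx)
  | unitRight (S : Sys d) :
      Rearrangement (S := S ⊠ unit) (T := S) (Equiv.prodPUnit S.idx)

end Sys

variable {E : Type u} {d : E → ℕ+}

/-- Operators on the Hilbert space of `S`. -/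
abbrev Op (S : Sys d) : Type := Matrix S.idx S.idx ℂ

/-! ### States, channels, distances -/

section General

variable {n m r : Type*} [Fintype n] [DecidableEq n] [Fintype m] [DecidableEq m]

/-- Density operators. -/
def IsState (ρ : Matrix n n ℂ) : Prop := ρ.PosSemidef ∧ ρ.trace = 1

/-- The trace norm `‖X‖₁ = Tr √(X† X)`. -/
def traceNorm (X : Matrix n n ℂ) : ℝ := (Matrix.trace (CFC.sqrt (X.conjTranspose * X))).re

/-- The fidelity `F(ρ,σ) = Tr √(√ρ σ √ρ)`. -/
def fidelity (ρ σ : Matrix n n ℂ) : ℝ :=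
  (Matrix.trace (CFC.sqrt (CFC.sqrt ρ * σ * CFC.sqrt ρ))).re

/-- The purified distance `D_F(ρ,σ) = √(1 - F(ρ,σ)²)`. -/
def purifiedDist (ρ σ : Matrix n n ℂ) : ℝ := Real.sqrt (1 - fidelity ρ σ ^ 2)

/-- The map `id_r ⊗ Φ`, acting blockwise. -/
def ampl (r : Type*) (Φ : Matrix n n ℂ → Matrix m m ℂ) (X : Matrix (r × n) (r × n) ℂ) :
    Matrix (r × m) (r × m) ℂ :=
  Matrix.of fun i j => Φ (Matrix.of fun s t => X (i.1, s) (j.1, t)) i.2 j.2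

/-- Quantum channels: completely positive trace-preserving linear maps. -/
structure IsChannel (Φ : Matrix n n ℂ →ₗ[ℂ] Matrix m m ℂ) : Prop where
  completelyPositive : ∀ (k : ℕ) (X : Matrix (Fin k × n) (Fin k × n) ℂ),
    X.PosSemidef → (ampl (Fin k) Φ X).PosSemidef
  tracePreserving : ∀ X : Matrix n n ℂ, (Φ X).trace = X.trace

/-- The channel purified distance: the supremum, over all finite-dimensional references and all
states `ρ`, of `D_F(id ⊗ Φ (ρ), id ⊗ Ψ (ρ))`.  (All these numbers lie in `[0,1]`.) -/
def channelDist (Φ Ψ : Matrix n n ℂ → Matrix m m ℂ) : ℝ :=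
  sSup {x | ∃ (k : ℕ) (ρ : Matrix (Fin k × n) (Fin k × n) ℂ), IsState ρ ∧
    x = purifiedDist (ampl (Fin k) Φ ρ) (ampl (Fin k) Ψ ρ)}

/-- Partial trace over the second tensor factor. -/
def partialTrace (X : Matrix (n × m) (n × m) ℂ) : Matrix n n ℂ :=
  Matrix.of fun i j => ∑ k, X (i, k) (j, k)

/-- Two-valued POVMs. -/
def IsPOVM (Q : Fin 2 → Matrix n n ℂ) : Prop := (∀ k, (Q k).PosSemidef) ∧ Q 0 + Q 1 = 1

/-- Two-valued PVMs. -/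
def IsPVM (P : Fin 2 → Matrix n n ℂ) : Prop :=
  (∀ k, (P k).IsHermitian ∧ P k * P k = P k) ∧ P 0 + P 1 = 1

/-- The prior probabilities `(p, 1 - p)`. -/
def prior (p : ℝ) : Fin 2 → ℝ := ![p, 1 - p]

/-- The probability of failing to discriminate the ensemble `(σ₁,σ₂)_p` with the POVM `Q`. -/
def failProb (p : ℝ) (σ Q : Fin 2 → Matrix n n ℂ) : ℝ :=
  ∑ k, prior p k * (Matrix.trace ((1 - Q k) * σ k)).re

/-- The irreversibility `δ(Λ,Ω_p)` of `Λ` for the test ensemble `Ω_p = (ρ₁,ρ₂)_p`. -/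
def irreversibility (Λ : Matrix n n ℂ →ₗ[ℂ] Matrix m m ℂ) (p : ℝ) (ρ : Fin 2 → Matrix n n ℂ) : ℝ :=
  Real.sqrt (sInf {x | ∃ 𝓡 : Matrix m m ℂ →ₗ[ℂ] Matrix n n ℂ, IsChannel 𝓡 ∧
    x = ∑ k, prior p k * purifiedDist (ρ k) (𝓡 (Λ (ρ k))) ^ 2})

/-- `|k⟩⟨k|` for the orthonormal basis `{|k⟩}` of a two-level register. -/
def regProj (κ : OrthonormalBasis (Fin 2) ℂ (EuclideanSpace ℂ n)) (k : Fin 2) : Matrix n n ℂ :=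
  Matrix.of fun i j => κ k i * star (κ k j)

/-- The measurement channel `X ↦ ∑ₖ Lₖ X Lₖ† ⊗ |k⟩⟨k|` with measurement operators `Lₖ`. -/
def measChannel (κ : OrthonormalBasis (Fin 2) ℂ (EuclideanSpace ℂ m)) (L : Fin 2 → Matrix n n ℂ)
    (X : Matrix n n ℂ) : Matrix (n × m) (n × m) ℂ :=
  ∑ k, (L k * X * (L k).conjTranspose) ⊗ₖ regProj κ k

end General

/-- The state `ρ^{⊗ m}` on `m` copies of `S`. -/
def tensorPow {S : Sys d} (ρ : Op S) : ∀ m : ℕ, Op (S.copies m)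
  | 0 => (1 : Matrix Unit Unit ℂ)
  | m + 1 => Matrix.kroneckerMap (· * ·) (tensorPow ρ m) ρ

/-! ### Resource measures -/

/-- The free states and the free unitaries of a resource theory.  A free unitary acts on a composite
system which may be decomposed into subsystems as `S` before the action and as `T` after it (as in
`AB = A'B'`); it is written as a matrix between the two product bases. -/
structure FreeSets (d : E → ℕ+) where
  freeState : ∀ S : Sys d, Set (Op S)
  isState : ∀ S, ∀ τ ∈ freeState S, IsState τ
  freeUnitary : ∀ S T : Sys d, Set (Matrix T.idx S.idx ℂ)
  isUnitary : ∀ S T, ∀ V ∈ freeUnitary S T, V.conjTranspose * V = 1 ∧ V * V.conjTranspose = 1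

/-- The map `id_R ⊗ 𝒱` with `𝒱(X) = V X V†`. -/
def conjRight (R : Sys d) {S T : Sys d} (V : Matrix T.idx S.idx ℂ) (X : Op (R ⊠ S)) : Op (R ⊠ T) :=
  ampl R.idx (fun Y : Op S => V * Y * V.conjTranspose) X

/-- The constants of the Hölder condition: for each system `S` the numbers `K S`, `a S`, `b S`, and
`a' S` (which only matters if `a S = ∞`), and the function `c` with its upper bound `cmax`. -/
structure HolderData (d : E → ℕ+) where
  K : Sys d → ℝ
  a : Sys d → ℝ≥0∞
  a' : Sys d → ℝ
  b : Sys d → ℝ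
  c : ℝ → ℝ
  cmax : ℝ

/-- The growth factor: `m ^ a_S` if `a_S < ∞`, and `exp (a'_S m)` if `a_S = ∞`. -/
def HolderData.growth (h : HolderData d) (S : Sys d) (m : ℕ) : ℝ :=
  if h.a S = ∞ then Real.exp (h.a' S * m) else (m : ℝ) ^ (h.a S).toReal

/-- `M` (of which only the values at density operators matter) is a resource measure with
properties (i) monotonicity, (ii) additivity on product states, (iii) Hölder continuity.
The field `rearrange` says that `M` is a function of the state alone: the order in which the
subsystems of a composite system are listed is irrelevant. -/
structure IsResourceMeasure (𝓕 : FreeSets d) (M : ∀ S : Sys d, Op S → ℝ) (h : HolderData d) :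
    Prop where
  rearrange : ∀ (S T : Sys d) (e : S.idx ≃ T.idx), Sys.Rearrangement e →
    ∀ ρ : Op S, IsState ρ → M T (ρ.submatrix e.symm e.symm) = M S ρ
  mono_addFree : ∀ (S T : Sys d) (ρ : Op S) (τ : Op T), IsState ρ → τ ∈ 𝓕.freeState T →
    M (S ⊠ T) (ρ ⊗ₖ τ) ≤ M S ρ
  mono_unitary : ∀ (R S T : Sys d) (V : Matrix T.idx S.idx ℂ), V ∈ 𝓕.freeUnitary S T →
    ∀ ρ : Op (R ⊠ S), IsState ρ → M (R ⊠ T) (conjRight R V ρ) ≤ M (R ⊠ S) ρ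
  mono_dual : ∀ (R S T : Sys d) (V : Matrix T.idx S.idx ℂ), V ∈ 𝓕.freeUnitary S T →
    ∀ ρ : Op (R ⊠ T), IsState ρ → M (R ⊠ S) (conjRight R V.conjTranspose ρ) ≤ M (R ⊠ T) ρ
  mono_partialTrace : ∀ (S T : Sys d) (ρ : Op (S ⊠ T)), IsState ρ →
    M S (partialTrace ρ) ≤ M (S ⊠ T) ρ
  additive : ∀ (S T : Sys d) (ρ : Op S) (σ : Op T), IsState ρ → IsState σ →
    M (S ⊠ T) (ρ ⊗ₖ σ) = M S ρ + M T σ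
  c_tendsto : Filter.Tendsto h.c (𝓝[>] 0) (𝓝 0)
  c_le : ∀ x ∈ Set.Icc (0 : ℝ) 2, h.c x ≤ h.cmax
  K_nonneg : ∀ S, 0 ≤ h.K S
  a_pos : ∀ S, 0 < h.a S
  b_pos : ∀ S, 0 < h.b S
  one_lt : ∀ S, 1 < h.a S + ENNReal.ofReal (h.b S)
  a'_add_b_pos : ∀ S, h.a S = ∞ → 0 < h.a' S + h.b S
  holder : ∀ (S : Sys d) (m : ℕ), 1 ≤ m → ∀ (ρ : Op S) (σ : Op (S.copies m)),
    IsState ρ → IsState σ →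
      |M (S.copies m) (tensorPow ρ m) - M (S.copies m) σ| ≤
        h.growth S m * h.K S * traceNorm (tensorPow ρ m - σ) ^ h.b S
          + h.c (traceNorm (tensorPow ρ m - σ))

/-! ### Cost, resource gain, and channel power -/

/-- The resource-increasing power `M(Γ)` of a channel `Γ` from `S` to `T`, the supremum over all
reference systems `R` and all states on `RS` of the resource gain under `id_R ⊗ Γ`. -/
def channelPower (M : ∀ S : Sys d, Op S → ℝ) (S T : Sys d) (Γ : Op S → Op T) : EReal :=
  ⨆ (R : Sys d) (σ : Op (R ⊠ S)) (_ : IsState σ),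
    ((M (R ⊠ T) (ampl R.idx Γ σ) - M (R ⊠ S) σ : ℝ) : EReal)

/-- The channel `X ↦ Tr_{B'} [V (X ⊗ η) V†]` from `A` to `A'`. -/
def implemented {A B A' B' : Sys d} (η : Op B) (V : Matrix (A' ⊠ B').idx (A ⊠ B).idx ℂ)
    (X : Op A) : Op A' :=
  partialTrace (V * (X ⊗ₖ η) * V.conjTranspose)

/-- The cost `M_c^ε(Λ)` of implementing `Λ` with error `ε`: the infimum of `M(η)` over all ancillary
states `η` from which some free unitary implements `Λ` up to channel purified distance `ε`.
It is `∞` if there is no such implementation. -/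
def implCost (𝓕 : FreeSets d) (M : ∀ S : Sys d, Op S → ℝ) (A A' : Sys d) (Λ : Op A → Op A')
    (ε : ℝ) : EReal :=
  sInf {x | ∃ (B B' : Sys d) (η : Op B) (V : Matrix (A' ⊠ B').idx (A ⊠ B).idx ℂ),
    IsState η ∧ V ∈ 𝓕.freeUnitary (A ⊠ B) (A' ⊠ B') ∧
      channelDist Λ (implemented η V) ≤ ε ∧ x = ((M B η : ℝ) : EReal)}

/-- The resource gain `M_em(Ω_p|𝒦)` of discriminating the test ensemble `Ω_p = (ρ₁,ρ₂)_p`, with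
register `K` and register basis `κ`. -/
def gainEm (M : ∀ S : Sys d, Op S → ℝ) (A K : Sys d)
    (κ : OrthonormalBasis (Fin 2) ℂ (EuclideanSpace ℂ K.idx)) (p : ℝ) (ρ : Fin 2 → Op A) : EReal :=
  sSup {x | ∃ (σ : Op A) (P : Fin 2 → Op A), IsState σ ∧ IsPVM P ∧
    (∀ k, (P k * ρ k).trace = 1) ∧
    measChannel κ P σ = ∑ k, ((prior p k : ℝ) : ℂ) • (ρ k ⊗ₖ regProj κ k) ∧
    x = ((M (A ⊠ K) (measChannel κ P σ) - M A σ : ℝ) : EReal)}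

/-- The channel power `M_cos(Γ_p|𝒦)` required to discriminate the ensemble `Γ_p = (σ₁,σ₂)_p`
optimally: the least power of a measurement channel of a POVM with minimal failure probability. -/
def powerCos (M : ∀ S : Sys d, Op S → ℝ) (A K : Sys d)
    (κ : OrthonormalBasis (Fin 2) ℂ (EuclideanSpace ℂ K.idx)) (p : ℝ) (σ : Fin 2 → Op A) : EReal :=
  sInf {x | ∃ Q : Fin 2 → Op A, IsPOVM Q ∧
    (∀ Q' : Fin 2 → Op A, IsPOVM Q' → failProb p σ Q ≤ failProb p σ Q') ∧
    x = channelPower M A (A ⊠ K) (measChannel κ fun k => CFC.sqrt (Q k))}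

/-- `|M_em(Ω_p|𝒦) - M_cos(Ω'_{p,Λ}|𝒦)|₊`, where `Ω'_{p,Λ} = (Λ(ρ₁),Λ(ρ₂))_p`. -/
def gap (M : ∀ S : Sys d, Op S → ℝ) (A A' K : Sys d)
    (κ : OrthonormalBasis (Fin 2) ℂ (EuclideanSpace ℂ K.idx)) (Λ : Op A → Op A')
    (p : ℝ) (ρ : Fin 2 → Op A) : ℝ≥0∞ :=
  (gainEm M A K κ p ρ - powerCos M A' K κ p fun k => Λ (ρ k)).toENNReal

/-! ### The lower bounds

The quotients are taken in `[0,∞]`, where `x / 0 = ∞` for `x > 0` and `0 / 0 = 0`. -/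

/-- `f(x) = 4x + x²`. -/
def fErr (x : ℝ) : ℝ := 4 * x + x ^ 2

/-- `g(a,b) = (1/(a+b))^{1/(a+b-1)} (1 - 1/(a+b))`. -/
def gConst (a b : ℝ) : ℝ := (1 / (a + b)) ^ (1 / (a + b - 1)) * (1 - 1 / (a + b))

/-- `g(a,b) G^{(a+b)/(a+b-1)} / (K f(x)^b)^{1/(a+b-1)} - G - cmax`. -/
def powerBound (a b K cmax : ℝ) (G : ℝ≥0∞) (x : ℝ) : EReal :=
  ((ENNReal.ofReal (gConst a b) *
      (G ^ ((a + b) / (a + b - 1)) / ENNReal.ofReal (K * fErr x ^ b) ^ (1 / (a + b - 1))) :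
      ℝ≥0∞) : EReal) - (G : EReal) - (cmax : EReal)

/-- `(G/(a'+b)) log (G / (K f(x)^b (a'+b))) - G (1 + 1/(a'+b)) - cmax`, where `0 log 0 = 0`. -/
def logBound (a' b K cmax : ℝ) (G : ℝ≥0∞) (x : ℝ) : EReal :=
  (G : EReal) * ((1 / (a' + b) : ℝ) : EReal) *
      ENNReal.log (G / ENNReal.ofReal (K * fErr x ^ b * (a' + b)))
    - (G : EReal) * ((1 + 1 / (a' + b) : ℝ) : EReal) - (cmax : EReal)

/-- `G² / (16 K x) - c'` with `c' = cmax + G + G² / (64 K)`. -/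
def linearBound (K cmax : ℝ) (G : ℝ≥0∞) (x : ℝ) : EReal :=
  ((G ^ 2 / ENNReal.ofReal (16 * K * x) : ℝ≥0∞) : EReal)
    - ((cmax : EReal) + (G : EReal) + ((G ^ 2 / ENNReal.ofReal (64 * K) : ℝ≥0∞) : EReal))

end

/-! An ancilla that implements `Λ` can be reused. Let η and V implement it, let Q discriminate the
outputs Λ(ρ₁), Λ(ρ₂) optimally, and let σ and P be as in the definition of M_em, with τ = Λ_P(σ).
One round (`protocolRound`) adjoins σ, applies V, measures Q on A' and undoes V. If Q fails on the
implemented outputs with probability at most x², the operators F_j = V†(√Q_j ⊗ 1)V act on σ ⊗ η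
almost like P_j ⊗ 1 (`gentle_measurement`). The round then yields τ and hands η back, up to 4x in
trace norm. V and V† cannot raise M, so a round adds at most M(σ) plus the power q of the
measurement.

Positive trace-preserving maps do not amplify errors, so m rounds with one ancilla give an error of
at most 4mx (`exists_protocol`). Discarding the ancilla, additivity and the Hölder condition give m
(M(τ) - M(σ) - q) ≤ M(η) + growth(m) K (4mx)^b + cmax (`mul_gain_le`). The bracket can be brought as
close to the gap G as desired (`exists_of_lt_gap`). Optimizing over m gives the bounds; they hold
with 4x, which is at most f(x). If x = 0 and G > 0, the left side is unbounded in m, so no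
implementation exists.

It remains to find x. For an exact implementation, pulling P back through a recovery map gives a
POVM whose failure probability is at most the recovery error; hence x = δ
(`failProb_le_irreversibility_sq`). If δ = 0 and the implementation has error ε, then Q is perfect
for Λ, and x = ε (`failProb_le_of_channelDist_le`). Both rest on `fidelity_sq_le`. -/

noncomputable section

universe u

/-! ### Trace norm and fidelity of matrices. -/

section MatrixFacts

set_option linter.unusedSectionVars false

variable {n m : Type*} [Fintype n] [DecidableEq n] [Fintype m] [DecidableEq m]

lemma Matrix.PosSemidef.sqrt_posSemidef (A : Matrix n n ℂ) : (CFC.sqrt A).PosSemidef :=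
  Matrix.nonneg_iff_posSemidef.1 (CFC.sqrt_nonneg A)

lemma Matrix.PosSemidef.sqrt_mul_sqrt {A : Matrix n n ℂ} (hA : A.PosSemidef) :
    CFC.sqrt A * CFC.sqrt A = A :=
  CFC.sqrt_mul_sqrt_self A (Matrix.nonneg_iff_posSemidef.2 hA)

lemma Matrix.conjTranspose_sqrt (A : Matrix n n ℂ) :
    (CFC.sqrt A).conjTranspose = CFC.sqrt A :=
  (Matrix.PosSemidef.sqrt_posSemidef A).isHermitian.eq

lemma Matrix.PosSemidef.re_trace_nonneg {A : Matrix n n ℂ} (hA : A.PosSemidef) :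
    0 ≤ A.trace.re :=
  (Complex.le_def.1 hA.trace_nonneg).1

lemma Matrix.PosSemidef.trace_eq_re {A : Matrix n n ℂ} (hA : A.PosSemidef) :
    A.trace = (A.trace.re : ℂ) :=
  Complex.ext rfl (by simpa using (Complex.le_def.1 hA.trace_nonneg).2.symm)

lemma Matrix.PosSemidef.re_trace_mul_nonneg {A B : Matrix n n ℂ} (hA : A.PosSemidef)
    (hB : B.PosSemidef) : 0 ≤ (A * B).trace.re := by
  have h := (hA.mul_mul_conjTranspose_same (CFC.sqrt B)).re_trace_nonneg
  rwa [Matrix.conjTranspose_sqrt, Matrix.mul_assoc, Matrix.trace_mul_comm, Matrix.mul_assoc,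
    hB.sqrt_mul_sqrt] at h

lemma Matrix.re_trace_conjTranspose (A : Matrix n n ℂ) :
    A.conjTranspose.trace.re = A.trace.re := by
  rw [Matrix.trace_conjTranspose]; simp

/-- Polar decomposition of the absolute value: `|Y| = W† Y` for a contraction `W`. -/
lemma exists_contraction_abs (Y : Matrix n n ℂ) : ∃ W : Matrix n n ℂ,
    (1 - W * W.conjTranspose).PosSemidef ∧
      CFC.sqrt (Y.conjTranspose * Y) = W.conjTranspose * Y := by
  set a := CFC.sqrt (Y.conjTranspose * Y) with ha
  have haa : a * a = Y.conjTranspose * Y :=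
    (Matrix.posSemidef_conjTranspose_mul_self Y).sqrt_mul_sqrt
  have hsa : IsSelfAdjoint a := (Matrix.PosSemidef.sqrt_posSemidef _).isHermitian
  have hc : ∀ f : ℝ → ℝ, ContinuousOn f (spectrum ℝ a) := fun f =>
    (Matrix.finite_real_spectrum (A := a)).continuousOn f
  -- Since 0⁻¹ = 0, this is the pseudo-inverse of |Y|, so Y g is the partial isometry of the polar
  -- decomposition. Continuity is automatic on a finite spectrum.
  set g := cfc (fun x : ℝ => x⁻¹) a with hg
  have hgs : g.conjTranspose = g := (cfc_predicate (fun x : ℝ => x⁻¹) a : IsSelfAdjoint g)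
  have hid : cfc (fun x : ℝ => x) a = a := cfc_id' ℝ a
  have hga : g * a = cfc (fun x : ℝ => x⁻¹ * x) a := by
    rw [cfc_mul _ _ _ (hc _) (hc _), hid]
  have hgaa : g * (a * a) = a := by
    have h1 : cfc (fun x : ℝ => x⁻¹ * x * x) a = g * a * a := by
      rw [cfc_mul _ _ _ (hc _) (hc _), hid, hga]
    rw [← mul_assoc, ← h1]
    refine Eq.trans (cfc_congr fun x _ => ?_) hid
    by_cases hx : x = 0
    · simp [hx]
    · field_simp
  have hgag : g * a * g = g := by
    have h1 : cfc (fun x : ℝ => x⁻¹ * x * x⁻¹) a = g * a * g := by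
      rw [cfc_mul _ _ _ (hc _) (hc _), hga]
    rw [← h1, hg]
    refine cfc_congr fun x _ => ?_
    by_cases hx : x = 0
    · simp [hx]
    · field_simp
  have hgg : g * (g * (a * a) * g) * g = g * g := by
    rw [hgaa, ← mul_assoc, hgag]
  refine ⟨Y * g, ?_, ?_⟩
  · set N := Y * g * (Y * g).conjTranspose with hN
    have hNh : N.conjTranspose = N := by simp [hN, Matrix.mul_assoc]
    have hNN : N * N = N := by
      have : N = Y * (g * g) * Y.conjTranspose := by
        simp [hN, hgs, Matrix.mul_assoc]
      rw [this]
      calc Y * (g * g) * Y.conjTranspose * (Y * (g * g) * Y.conjTranspose)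
          = Y * (g * (g * (Y.conjTranspose * Y) * g) * g) * Y.conjTranspose := by
            simp only [Matrix.mul_assoc]
        _ = _ := by rw [← haa, hgg]
    have : 1 - N = (1 - N).conjTranspose * (1 - N) := by
      simp [hNh, Matrix.sub_mul, Matrix.mul_sub, hNN]
    rw [this]
    exact Matrix.posSemidef_conjTranspose_mul_self _
  · rw [Matrix.conjTranspose_mul, hgs, Matrix.mul_assoc, ← haa, hgaa]

/-- Expand Tr[(1 ± W)† P (1 ± W)] ≥ 0 and use Tr[W† P W] ≤ Tr P. -/
lemma re_trace_contraction_mul_le {W P : Matrix n n ℂ} (hW : (1 - W * W.conjTranspose).PosSemidef)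
    (hP : P.PosSemidef) : |(W.conjTranspose * P).trace.re| ≤ P.trace.re := by
  have h2 := hP.re_trace_mul_nonneg hW
  rw [Matrix.mul_sub, Matrix.trace_sub, Matrix.mul_one, Complex.sub_re] at h2
  have e1 : (W.conjTranspose * P * W).trace = (P * (W * W.conjTranspose)).trace := by
    rw [Matrix.trace_mul_comm, ← Matrix.mul_assoc, Matrix.trace_mul_comm]
  have e2 : (P * W).trace.re = (W.conjTranspose * P).trace.re := by
    rw [← Matrix.re_trace_conjTranspose, Matrix.conjTranspose_mul, hP.isHermitian.eq]
  rw [abs_le]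
  constructor
  · have h1 := (hP.conjTranspose_mul_mul_same (1 + W)).re_trace_nonneg
    simp only [Matrix.conjTranspose_add, Matrix.conjTranspose_one, Matrix.add_mul, Matrix.mul_add,
      Matrix.one_mul, Matrix.mul_one, Matrix.trace_add, Complex.add_re] at h1
    rw [e1, e2] at h1
    linarith
  · have h1 := (hP.conjTranspose_mul_mul_same (1 - W)).re_trace_nonneg
    simp only [Matrix.conjTranspose_sub, Matrix.conjTranspose_one, Matrix.sub_mul, Matrix.mul_sub,
      Matrix.one_mul, Matrix.mul_one, Matrix.trace_sub, Complex.sub_re] at h1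
    rw [e1, e2] at h1
    linarith

lemma trace_submatrix_equiv (X : Matrix n n ℂ) (e : m ≃ n) :
    (X.submatrix e e).trace = X.trace :=
  Equiv.sum_comp e fun i => X i i

/-- `X` is a difference of positive operators whose traces add up to at most `t`. -/
def TraceBound (X : Matrix n n ℂ) (t : ℝ) : Prop :=
  ∃ P N : Matrix n n ℂ, P.PosSemidef ∧ N.PosSemidef ∧ X = P - N ∧ P.trace.re + N.trace.re ≤ t

/-- Errors are tracked through `TraceBound`, which passes through positive trace-preserving maps
without a Jordan decomposition; the trace norm appears only here. With the polar contraction W, ‖P -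
N‖₁ = Re Tr[W†(P - N)], and each term is at most the trace of P or N in absolute value. -/
lemma TraceBound.traceNorm_le {X : Matrix n n ℂ} {t : ℝ} (h : TraceBound X t) :
    traceNorm X ≤ t := by
  obtain ⟨P, N, hP, hN, rfl, ht⟩ := h
  obtain ⟨W, hW, hY⟩ := exists_contraction_abs (P - N)
  rw [traceNorm, hY, Matrix.mul_sub, Matrix.trace_sub, Complex.sub_re]
  have h1 := abs_le.1 (re_trace_contraction_mul_le hW hP)
  have h2 := abs_le.1 (re_trace_contraction_mul_le hW hN)
  linarith [h1.2, h2.1]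

lemma traceNorm_nonneg (X : Matrix n n ℂ) : 0 ≤ traceNorm X :=
  (Matrix.PosSemidef.sqrt_posSemidef _).re_trace_nonneg

lemma TraceBound.add {X Y : Matrix n n ℂ} {s t : ℝ} (hX : TraceBound X s) (hY : TraceBound Y t) :
    TraceBound (X + Y) (s + t) := by
  obtain ⟨P, N, hP, hN, rfl, ht⟩ := hX
  obtain ⟨P', N', hP', hN', rfl, ht'⟩ := hY
  refine ⟨P + P', N + N', hP.add hP', hN.add hN', by abel, ?_⟩
  simp only [Matrix.trace_add, Complex.add_re]
  linarith

lemma TraceBound.mono {X : Matrix n n ℂ} {s t : ℝ} (hX : TraceBound X s) (h : s ≤ t) :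
    TraceBound X t := by
  obtain ⟨P, N, hP, hN, rfl, ht⟩ := hX
  exact ⟨P, N, hP, hN, rfl, ht.trans h⟩

lemma TraceBound.zero : TraceBound (0 : Matrix n n ℂ) 0 :=
  ⟨0, 0, .zero, .zero, by simp, by simp⟩

lemma TraceBound.sub_of_isState {ρ σ : Matrix n n ℂ} (hρ : IsState ρ) (hσ : IsState σ) :
    TraceBound (ρ - σ) 2 :=
  ⟨ρ, σ, hρ.1, hσ.1, rfl, by rw [hρ.2, hσ.2]; norm_num⟩

lemma TraceBound.submatrix {X : Matrix n n ℂ} {t : ℝ} (hX : TraceBound X t) (e : m ≃ n) :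
    TraceBound (X.submatrix e e) t := by
  obtain ⟨P, N, hP, hN, rfl, ht⟩ := hX
  refine ⟨_, _, hP.submatrix e, hN.submatrix e, rfl, ?_⟩
  simpa only [trace_submatrix_equiv] using ht

lemma TraceBound.kronecker {X : Matrix n n ℂ} {t : ℝ} (hX : TraceBound X t) {T : Matrix m m ℂ}
    (hT : IsState T) : TraceBound (T ⊗ₖ X) t := by
  obtain ⟨P, N, hP, hN, rfl, ht⟩ := hX
  refine ⟨_, _, hT.1.kronecker hP, hT.1.kronecker hN, ?_, ?_⟩
  · ext ⟨i, j⟩ ⟨k, l⟩; simp [mul_sub]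
  · simpa [Matrix.trace_kronecker, hT.2] using ht

/-! ### Fidelity -/

/-- Polar decomposition of √σ√ρ makes the fidelity linear in √ρ, which opens the way to
Cauchy–Schwarz. -/
lemma exists_contraction_fidelity (ρ σ : Matrix n n ℂ) (hσ : σ.PosSemidef) :
    ∃ W : Matrix n n ℂ, (1 - W * W.conjTranspose).PosSemidef ∧
      fidelity ρ σ = (W.conjTranspose * (CFC.sqrt σ * CFC.sqrt ρ)).trace.re := by
  obtain ⟨W, hW, h⟩ := exists_contraction_abs (CFC.sqrt σ * CFC.sqrt ρ)
  refine ⟨W, hW, ?_⟩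
  rw [← h, fidelity, Matrix.conjTranspose_mul, Matrix.conjTranspose_sqrt,
    Matrix.conjTranspose_sqrt, Matrix.mul_assoc (CFC.sqrt ρ) (CFC.sqrt σ),
    ← Matrix.mul_assoc (CFC.sqrt σ) (CFC.sqrt σ), hσ.sqrt_mul_sqrt, ← Matrix.mul_assoc]

lemma mul_sqrt_eq_zero {ρ R : Matrix n n ℂ} (hρ : ρ.PosSemidef) (hR : R.PosSemidef)
    (h : (R * ρ).trace.re = 0) : CFC.sqrt R * CFC.sqrt ρ = 0 := by
  rw [← Matrix.trace_mul_conjTranspose_self_eq_zero_iff]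
  have e : (CFC.sqrt R * CFC.sqrt ρ) * (CFC.sqrt R * CFC.sqrt ρ).conjTranspose
      = CFC.sqrt R * ρ * CFC.sqrt R := by
    rw [Matrix.conjTranspose_mul, Matrix.conjTranspose_sqrt, Matrix.conjTranspose_sqrt,
      Matrix.mul_assoc, ← Matrix.mul_assoc (CFC.sqrt ρ), hρ.sqrt_mul_sqrt, ← Matrix.mul_assoc]
  have e2 : (CFC.sqrt R * ρ * CFC.sqrt R).trace = (R * ρ).trace := by
    rw [Matrix.trace_mul_comm, ← Matrix.mul_assoc, hR.sqrt_mul_sqrt]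
  rw [(Matrix.posSemidef_self_mul_conjTranspose _).trace_eq_re, e, e2, h]
  simp

/-- If the effect `Q` is certain on the state `ρ`, then `F(ρ,σ)² ≤ Tr[Qσ]`. -/
lemma fidelity_sq_le {ρ σ Q : Matrix n n ℂ} (hρ : IsState ρ) (hσ : σ.PosSemidef)
    (hQ : Q.PosSemidef) (hQ1 : (1 - Q).PosSemidef) (h : (Q * ρ).trace.re = 1) :
    fidelity ρ σ ^ 2 ≤ (Q * σ).trace.re := by
  -- Certainty of Q puts the support of ρ into the eigenspace of Q for the eigenvalue 1, so Q may be
  -- inserted into the fidelity for free.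
  have hQρ : Q * CFC.sqrt ρ = CFC.sqrt ρ := by
    have h0 : ((1 - Q) * ρ).trace.re = 0 := by
      simp [Matrix.sub_mul, hρ.2, h]
    have := mul_sqrt_eq_zero hρ.1 hQ1 h0
    have h1 : (1 - Q) * CFC.sqrt ρ = 0 := by
      rw [← hQ1.sqrt_mul_sqrt, Matrix.mul_assoc, this, Matrix.mul_zero]
    rw [Matrix.sub_mul, Matrix.one_mul, sub_eq_zero] at h1
    exact h1.symm
  obtain ⟨W, hW, hF⟩ := exists_contraction_fidelity ρ σ hσ
  set F := fidelity ρ σ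
  set A := Q * CFC.sqrt σ * W with hA
  have hFA : F = (A.conjTranspose * CFC.sqrt ρ).trace.re := by
    rw [hF, hA]
    simp only [Matrix.conjTranspose_mul, Matrix.conjTranspose_sqrt, hQ.isHermitian.eq,
      Matrix.mul_assoc, hQρ]
  have hAA : (A.conjTranspose * A).trace.re ≤ (Q * σ).trace.re := by
    have h1 := ((hσ.mul_mul_conjTranspose_same Q)).re_trace_nonneg
    have e : (A.conjTranspose * A).trace
        = ((CFC.sqrt σ * Q * Q * CFC.sqrt σ) * (W * W.conjTranspose)).trace := by
      rw [hA]
      simp only [Matrix.conjTranspose_mul, Matrix.conjTranspose_sqrt, hQ.isHermitian.eq]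
      rw [Matrix.mul_assoc, Matrix.trace_mul_comm]
      simp only [Matrix.mul_assoc]
    have hp : (CFC.sqrt σ * Q * Q * CFC.sqrt σ).PosSemidef := by
      have := Matrix.posSemidef_self_mul_conjTranspose (CFC.sqrt σ * Q)
      simpa [Matrix.conjTranspose_mul, Matrix.conjTranspose_sqrt, hQ.isHermitian.eq,
        Matrix.mul_assoc] using this
    have h2 := hp.re_trace_mul_nonneg hW
    rw [Matrix.mul_sub, Matrix.mul_one, Matrix.trace_sub, Complex.sub_re, ← e] at h2
    have e3 : (CFC.sqrt σ * Q * Q * CFC.sqrt σ).trace = (Q * Q * σ).trace := by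
      rw [Matrix.trace_mul_comm, ← Matrix.mul_assoc, ← Matrix.mul_assoc, hσ.sqrt_mul_sqrt,
        Matrix.mul_assoc, Matrix.trace_mul_comm]
    rw [e3] at h2
    have hqq : (Q - Q * Q).PosSemidef := by
      have h3 : Q - Q * Q = CFC.sqrt Q * (1 - Q) * (CFC.sqrt Q).conjTranspose := by
        have hcomm : CFC.sqrt Q * Q = Q * CFC.sqrt Q := by
          have hs := hQ.sqrt_mul_sqrt
          calc CFC.sqrt Q * Q = CFC.sqrt Q * (CFC.sqrt Q * CFC.sqrt Q) := by rw [hs]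
            _ = Q * CFC.sqrt Q := by rw [← Matrix.mul_assoc, hs]
        rw [Matrix.conjTranspose_sqrt, Matrix.mul_sub, Matrix.mul_one, hcomm, Matrix.sub_mul,
          Matrix.mul_assoc Q, hQ.sqrt_mul_sqrt]
      rw [h3]
      exact hQ1.mul_mul_conjTranspose_same _
    have h4 := hqq.re_trace_mul_nonneg hσ
    rw [Matrix.sub_mul, Matrix.trace_sub, Complex.sub_re] at h4
    linarith
  have hρρ : (CFC.sqrt ρ * CFC.sqrt ρ).trace.re = 1 := by
    rw [hρ.1.sqrt_mul_sqrt, hρ.2]; rfl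
  -- Cauchy–Schwarz for F = Re Tr[A†√ρ], in discriminant form: the quadratic dominates ‖√ρ - tA‖² in
  -- the Hilbert–Schmidt norm.
  have key : ∀ t : ℝ, 0 ≤ (Q * σ).trace.re * (t * t) + (-2 * F) * t + 1 := by
    intro t
    have h1 := (Matrix.posSemidef_conjTranspose_mul_self
      (CFC.sqrt ρ - (t : ℂ) • A)).re_trace_nonneg
    have e : (CFC.sqrt ρ * A).trace.re = F := by
      rw [← Matrix.re_trace_conjTranspose, Matrix.conjTranspose_mul, Matrix.conjTranspose_sqrt,
        hFA]
    simp only [Matrix.conjTranspose_sub, Matrix.conjTranspose_smul, Matrix.conjTranspose_sqrt,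
      Matrix.sub_mul, Matrix.mul_sub, Matrix.trace_sub, Complex.sub_re, hρρ, Matrix.smul_mul,
      Matrix.mul_smul, Matrix.trace_smul, smul_eq_mul, Complex.star_def, Complex.conj_ofReal,
      Complex.re_ofReal_mul, e, ← hFA] at h1
    nlinarith [mul_self_nonneg t]
  have := discrim_le_zero key
  rw [discrim] at this
  nlinarith

/-- The equality case of Cauchy–Schwarz: √ρ = √σ W with a contraction W, so ρ ≤ σ, and equal traces
force equality. -/
lemma eq_of_one_le_fidelity {ρ σ : Matrix n n ℂ} (hρ : IsState ρ) (hσ : IsState σ)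
    (h : 1 ≤ fidelity ρ σ) : ρ = σ := by
  obtain ⟨W, hW, hF⟩ := exists_contraction_fidelity ρ σ hσ.1
  set A := CFC.sqrt σ * W with hA
  have hFA : fidelity ρ σ = (A.conjTranspose * CFC.sqrt ρ).trace.re := by
    rw [hF, hA]
    simp only [Matrix.conjTranspose_mul, Matrix.conjTranspose_sqrt, Matrix.mul_assoc]
  have hAA : (A.conjTranspose * A).trace.re ≤ 1 := by
    have e : (A.conjTranspose * A).trace = (σ * (W * W.conjTranspose)).trace := by
      rw [hA]
      simp only [Matrix.conjTranspose_mul, Matrix.conjTranspose_sqrt]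
      rw [Matrix.mul_assoc, ← Matrix.mul_assoc (CFC.sqrt σ), hσ.1.sqrt_mul_sqrt,
        Matrix.trace_mul_comm, Matrix.mul_assoc]
    have h2 := hσ.1.re_trace_mul_nonneg hW
    rw [Matrix.mul_sub, Matrix.mul_one, Matrix.trace_sub, Complex.sub_re, ← e, hσ.2,
      Complex.one_re] at h2
    linarith
  have hρρ : (CFC.sqrt ρ * CFC.sqrt ρ).trace.re = 1 := by
    rw [hρ.1.sqrt_mul_sqrt, hρ.2]; rfl
  have e : (CFC.sqrt ρ * A).trace.re = fidelity ρ σ := by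
    rw [← Matrix.re_trace_conjTranspose, Matrix.conjTranspose_mul, Matrix.conjTranspose_sqrt, hFA]
  have hpos := Matrix.posSemidef_conjTranspose_mul_self (CFC.sqrt ρ - A)
  have h1 := hpos.re_trace_nonneg
  have h1' : ((CFC.sqrt ρ - A).conjTranspose * (CFC.sqrt ρ - A)).trace.re ≤ 0 := by
    simp only [Matrix.conjTranspose_sub, Matrix.conjTranspose_sqrt,
      Matrix.sub_mul, Matrix.mul_sub, Matrix.trace_sub, Complex.sub_re, hρρ, e, ← hFA]
    linarith
  have h0 : CFC.sqrt ρ - A = 0 := by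
    rw [← Matrix.trace_conjTranspose_mul_self_eq_zero_iff, hpos.trace_eq_re, le_antisymm h1' h1]
    simp
  have hρA : ρ = CFC.sqrt σ * (W * W.conjTranspose) * CFC.sqrt σ := by
    have : ρ = CFC.sqrt ρ * (CFC.sqrt ρ).conjTranspose := by
      rw [Matrix.conjTranspose_sqrt, hρ.1.sqrt_mul_sqrt]
    rw [this, sub_eq_zero.1 h0, hA, Matrix.conjTranspose_mul, Matrix.conjTranspose_sqrt]
    simp only [Matrix.mul_assoc]
  have hd : (σ - ρ).PosSemidef := by
    have h3 := hW.mul_mul_conjTranspose_same (CFC.sqrt σ)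
    rwa [Matrix.conjTranspose_sqrt, Matrix.mul_sub, Matrix.sub_mul, Matrix.mul_one,
      hσ.1.sqrt_mul_sqrt, ← hρA] at h3
  have h4 := hd.trace_eq_zero_iff.1 (by rw [Matrix.trace_sub, hρ.2, hσ.2, sub_self])
  exact (sub_eq_zero.1 h4).symm

lemma one_sub_fidelity_sq_le (ρ σ : Matrix n n ℂ) :
    1 - fidelity ρ σ ^ 2 ≤ purifiedDist ρ σ ^ 2 := by
  rw [purifiedDist]
  rcases le_total 0 (1 - fidelity ρ σ ^ 2) with h | h
  · rw [Real.sq_sqrt h]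
  · exact h.trans (sq_nonneg _)

lemma purifiedDist_nonneg (ρ σ : Matrix n n ℂ) : 0 ≤ purifiedDist ρ σ := Real.sqrt_nonneg _

lemma purifiedDist_le_one (ρ σ : Matrix n n ℂ) : purifiedDist ρ σ ≤ 1 := by
  rw [purifiedDist, Real.sqrt_le_one]
  linarith [sq_nonneg (fidelity ρ σ)]

lemma fidelity_nonneg (ρ σ : Matrix n n ℂ) : 0 ≤ fidelity ρ σ :=
  (Matrix.PosSemidef.sqrt_posSemidef _).re_trace_nonneg

lemma eq_of_purifiedDist_le_zero {ρ σ : Matrix n n ℂ} (hρ : IsState ρ) (hσ : IsState σ)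
    (h : purifiedDist ρ σ ≤ 0) : ρ = σ := by
  refine eq_of_one_le_fidelity hρ hσ ?_
  have h1 := one_sub_fidelity_sq_le ρ σ
  have h2 : purifiedDist ρ σ = 0 := le_antisymm h (purifiedDist_nonneg _ _)
  rw [h2] at h1
  nlinarith [fidelity_nonneg ρ σ]

end MatrixFacts

/-! ### Positive trace-preserving maps, amplifications and measurement channels. -/

section PositiveMaps

set_option linter.unusedSectionVars false

variable {n m l r : Type*} [Fintype n] [DecidableEq n] [Fintype m] [DecidableEq m]
  [Fintype l] [DecidableEq l] [Fintype r] [DecidableEq r]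

/-- Additive maps that preserve positivity and the trace. -/
structure IsPositiveTP (Φ : Matrix n n ℂ → Matrix m m ℂ) : Prop where
  map_sub : ∀ X Y, Φ (X - Y) = Φ X - Φ Y
  psd : ∀ X, X.PosSemidef → (Φ X).PosSemidef
  trace : ∀ X, (Φ X).trace = X.trace

lemma IsPositiveTP.isState {Φ : Matrix n n ℂ → Matrix m m ℂ} (h : IsPositiveTP Φ)
    {ρ : Matrix n n ℂ} (hρ : IsState ρ) : IsState (Φ ρ) :=
  ⟨h.psd _ hρ.1, by rw [h.trace, hρ.2]⟩

lemma IsPositiveTP.traceBound {Φ : Matrix n n ℂ → Matrix m m ℂ} (h : IsPositiveTP Φ)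
    {X : Matrix n n ℂ} {t : ℝ} (hX : TraceBound X t) : TraceBound (Φ X) t := by
  obtain ⟨P, N, hP, hN, rfl, ht⟩ := hX
  exact ⟨Φ P, Φ N, h.psd _ hP, h.psd _ hN, h.map_sub _ _, by rwa [h.trace, h.trace]⟩

lemma IsPositiveTP.comp {Φ : Matrix n n ℂ → Matrix m m ℂ} {Ψ : Matrix m m ℂ → Matrix l l ℂ}
    (hΨ : IsPositiveTP Ψ) (hΦ : IsPositiveTP Φ) : IsPositiveTP fun X => Ψ (Φ X) :=
  ⟨fun X Y => by rw [hΦ.map_sub, hΨ.map_sub], fun X hX => hΨ.psd _ (hΦ.psd _ hX),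
    fun X => by rw [hΨ.trace, hΦ.trace]⟩

lemma isPositiveTP_submatrix (e : m ≃ n) :
    IsPositiveTP fun X : Matrix n n ℂ => X.submatrix e e :=
  ⟨fun _ _ => rfl, fun _ hX => hX.submatrix e, fun X => trace_submatrix_equiv X e⟩

lemma isPositiveTP_kronecker {σ : Matrix m m ℂ} (hσ : IsState σ) :
    IsPositiveTP fun X : Matrix n n ℂ => X ⊗ₖ σ :=
  ⟨fun X Y => by ext ⟨i, j⟩ ⟨k, l⟩; simp [sub_mul], fun _ hX => hX.kronecker hσ.1,
    fun X => by simp [Matrix.trace_kronecker, hσ.2]⟩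

lemma isPositiveTP_conj {V : Matrix m n ℂ} (hV : V.conjTranspose * V = 1) :
    IsPositiveTP fun X : Matrix n n ℂ => V * X * V.conjTranspose :=
  ⟨fun X Y => by simp [Matrix.mul_sub, Matrix.sub_mul],
    fun _ hX => hX.mul_mul_conjTranspose_same V,
    fun X => by rw [Matrix.trace_mul_comm, ← Matrix.mul_assoc, hV, Matrix.one_mul]⟩

lemma trace_partialTrace (X : Matrix (n × m) (n × m) ℂ) : (partialTrace X).trace = X.trace := by
  simp [Matrix.trace, partialTrace, Fintype.sum_prod_type]

lemma isPositiveTP_partialTrace :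
    IsPositiveTP (partialTrace : Matrix (n × m) (n × m) ℂ → Matrix n n ℂ) := by
  refine ⟨fun X Y => ?_, fun X hX => ?_, trace_partialTrace⟩
  · ext i j; simp [partialTrace]
  · have : partialTrace X = ∑ k, X.submatrix (fun i => (i, k)) (fun i => (i, k)) := by
      ext i j; simp [partialTrace, Matrix.sum_apply]
    rw [this]
    exact Matrix.posSemidef_sum _ fun k _ => hX.submatrix _

lemma trace_mul_partialTrace (Q : Matrix n n ℂ) (X : Matrix (n × m) (n × m) ℂ) :
    (Q * partialTrace X).trace = ((Q ⊗ₖ (1 : Matrix m m ℂ)) * X).trace := by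
  simp only [Matrix.trace, Matrix.diag_apply, Matrix.mul_apply, partialTrace, Matrix.of_apply,
    Fintype.sum_prod_type, Matrix.kroneckerMap_apply, Matrix.one_apply, mul_ite, mul_one, mul_zero,
    ite_mul, zero_mul, Finset.sum_ite_eq, Finset.mem_univ, if_true, Finset.mul_sum]
  refine Finset.sum_congr rfl fun i _ => Finset.sum_comm

/-! ### Amplifications -/

lemma ampl_sum {ι : Type*} (s : Finset ι) (Φ : ι → Matrix n n ℂ → Matrix m m ℂ)
    (X : Matrix (r × n) (r × n) ℂ) :
    ampl r (fun Y => ∑ k ∈ s, Φ k Y) X = ∑ k ∈ s, ampl r (Φ k) X := by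
  ext i j; simp [ampl, Matrix.sum_apply]

lemma ampl_conj (V : Matrix m n ℂ) (X : Matrix (r × n) (r × n) ℂ) :
    ampl r (fun Y => V * Y * V.conjTranspose) X =
      ((1 : Matrix r r ℂ) ⊗ₖ V) * X * ((1 : Matrix r r ℂ) ⊗ₖ V).conjTranspose := by
  ext ⟨i, a⟩ ⟨j, b⟩
  simp only [ampl, Matrix.of_apply, Matrix.mul_apply, Fintype.sum_prod_type,
    Matrix.kroneckerMap_apply, Matrix.conjTranspose_apply, Matrix.one_apply, ite_mul, one_mul,
    zero_mul, Finset.sum_ite_irrel, Finset.sum_const_zero, Finset.sum_ite_eq, Finset.mem_univ,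
    if_true, apply_ite star, star_zero, mul_ite, mul_zero]

lemma ampl_kronecker {Φ : Matrix n n ℂ → Matrix m m ℂ} (hΦ : ∀ (c : ℂ) Y, Φ (c • Y) = c • Φ Y)
    (T : Matrix r r ℂ) (Y : Matrix n n ℂ) : ampl r Φ (T ⊗ₖ Y) = T ⊗ₖ Φ Y := by
  ext ⟨i, a⟩ ⟨j, b⟩
  exact congrFun₂ (hΦ (T i j) Y) a b

lemma ampl_sub {Φ : Matrix n n ℂ → Matrix m m ℂ} (hΦ : ∀ X Y, Φ (X - Y) = Φ X - Φ Y)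
    (X Y : Matrix (r × n) (r × n) ℂ) : ampl r Φ (X - Y) = ampl r Φ X - ampl r Φ Y := by
  ext i j
  exact congrFun₂ (hΦ _ _) i.2 j.2

lemma trace_ampl {Φ : Matrix n n ℂ → Matrix m m ℂ} (hΦ : ∀ X, (Φ X).trace = X.trace)
    (X : Matrix (r × n) (r × n) ℂ) : (ampl r Φ X).trace = X.trace := by
  simp only [Matrix.trace, Fintype.sum_prod_type]
  exact Finset.sum_congr rfl fun i _ => hΦ (Matrix.of fun s t => X (i, s) (i, t))

lemma isPositiveTP_ampl_conj {V : Matrix m n ℂ} (hV : V.conjTranspose * V = 1) :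
    IsPositiveTP (ampl r fun Y : Matrix n n ℂ => V * Y * V.conjTranspose) := by
  have h := isPositiveTP_conj hV
  refine ⟨ampl_sub h.map_sub, fun X hX => ?_, trace_ampl h.trace⟩
  rw [ampl_conj]
  exact hX.mul_mul_conjTranspose_same _

/-! ### Measurement channels -/

lemma regProj_posSemidef (κ : OrthonormalBasis (Fin 2) ℂ (EuclideanSpace ℂ m)) (k : Fin 2) :
    (regProj κ k).PosSemidef := by
  have : regProj κ k = Matrix.vecMulVec (κ k) (star (κ k : m → ℂ)) := by
    ext i j; simp [regProj, Matrix.vecMulVec_apply]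
  rw [this]
  exact Matrix.posSemidef_vecMulVec_self_star _

lemma sum_star_mul_basis (κ : OrthonormalBasis (Fin 2) ℂ (EuclideanSpace ℂ m)) (j k : Fin 2) :
    ∑ s, star (κ j s) * κ k s = if j = k then 1 else 0 := by
  rw [← orthonormal_iff_ite.1 κ.orthonormal j k, PiLp.inner_apply]
  simp [mul_comm]

lemma regProj_trace (κ : OrthonormalBasis (Fin 2) ℂ (EuclideanSpace ℂ m)) (k : Fin 2) :
    (regProj κ k).trace = 1 := by
  have := sum_star_mul_basis κ k k
  simpa [Matrix.trace, regProj, mul_comm] using this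

lemma regProj_isState (κ : OrthonormalBasis (Fin 2) ℂ (EuclideanSpace ℂ m)) (k : Fin 2) :
    IsState (regProj κ k) := ⟨regProj_posSemidef κ k, regProj_trace κ k⟩

/-- The register component of an operator `∑ₖ Xₖ ⊗ |k⟩⟨k|`. -/
lemma eq_of_sum_kronecker_regProj_eq (κ : OrthonormalBasis (Fin 2) ℂ (EuclideanSpace ℂ m))
    {X Y : Fin 2 → Matrix n n ℂ}
    (h : ∑ k, X k ⊗ₖ regProj κ k = ∑ k, Y k ⊗ₖ regProj κ k) (j : Fin 2) : X j = Y j := by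
  -- Sandwiching the register between ⟨κ j| and |κ j⟩ isolates the j-th term by orthonormality.
  have key : ∀ (Z : Fin 2 → Matrix n n ℂ) (a b : n),
      ∑ s, ∑ t, star (κ j s) * (∑ k, Z k ⊗ₖ regProj κ k) (a, s) (b, t) * κ j t = Z j a b := by
    intro Z a b
    have : ∀ s t, star (κ j s) * (∑ k, Z k ⊗ₖ regProj κ k) (a, s) (b, t) * κ j t
        = ∑ k, Z k a b * ((star (κ j s) * κ k s) * (star (κ k t) * κ j t)) := by
      intro s t
      simp only [Matrix.sum_apply, Matrix.kroneckerMap_apply, regProj, Matrix.of_apply,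
        Finset.mul_sum, Finset.sum_mul]
      exact Finset.sum_congr rfl fun k _ => by ring
    simp only [this]
    rw [Finset.sum_congr rfl fun s _ => Finset.sum_comm, Finset.sum_comm]
    simp only [← Finset.mul_sum, ← Finset.sum_mul, sum_star_mul_basis]
    fin_cases j <;> simp
  ext a b
  rw [← key X, ← key Y, h]

lemma measChannel_smul (κ : OrthonormalBasis (Fin 2) ℂ (EuclideanSpace ℂ m))
    (L : Fin 2 → Matrix n n ℂ) (c : ℂ) (X : Matrix n n ℂ) :
    measChannel κ L (c • X) = c • measChannel κ L X := by
  simp [measChannel, Matrix.smul_kronecker]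

lemma trace_measChannel (κ : OrthonormalBasis (Fin 2) ℂ (EuclideanSpace ℂ m))
    {L : Fin 2 → Matrix n n ℂ} (hL : ∑ k, (L k).conjTranspose * L k = 1) (X : Matrix n n ℂ) :
    (measChannel κ L X).trace = X.trace := by
  have : ∀ k, (L k * X * (L k).conjTranspose).trace
      = ((L k).conjTranspose * L k * X).trace := fun k => by
    rw [Matrix.trace_mul_comm, ← Matrix.mul_assoc]
  simp only [measChannel, Matrix.trace_sum, Matrix.trace_kronecker, regProj_trace, mul_one, this]
  rw [← Matrix.trace_sum, ← Finset.sum_mul, hL, Matrix.one_mul]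

lemma measChannel_sub (κ : OrthonormalBasis (Fin 2) ℂ (EuclideanSpace ℂ m))
    (L : Fin 2 → Matrix n n ℂ) (X Y : Matrix n n ℂ) :
    measChannel κ L (X - Y) = measChannel κ L X - measChannel κ L Y := by
  simp only [measChannel, ← Finset.sum_sub_distrib]
  refine Finset.sum_congr rfl fun k _ => ?_
  ext ⟨i, j⟩ ⟨k, l⟩
  simp [Matrix.mul_sub, sub_mul]

lemma isPositiveTP_measChannel (κ : OrthonormalBasis (Fin 2) ℂ (EuclideanSpace ℂ m))
    {L : Fin 2 → Matrix n n ℂ} (hL : ∑ k, (L k).conjTranspose * L k = 1) :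
    IsPositiveTP (measChannel κ L) :=
  ⟨measChannel_sub κ L, fun _ hX => Matrix.posSemidef_sum _ fun k _ =>
    (hX.mul_mul_conjTranspose_same _).kronecker (regProj_posSemidef κ k),
    trace_measChannel κ hL⟩

lemma isPositiveTP_ampl_measChannel (κ : OrthonormalBasis (Fin 2) ℂ (EuclideanSpace ℂ m))
    {L : Fin 2 → Matrix n n ℂ} (hL : ∑ k, (L k).conjTranspose * L k = 1) :
    IsPositiveTP (ampl r (measChannel κ L)) := by
  refine ⟨ampl_sub (measChannel_sub κ L), fun X hX => ?_, trace_ampl (trace_measChannel κ hL)⟩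
  have : ampl r (measChannel κ L) X =
      ∑ k, (ampl r (fun Y => L k * Y * (L k).conjTranspose) X ⊗ₖ regProj κ k).submatrix
        (Equiv.prodAssoc r n m).symm (Equiv.prodAssoc r n m).symm := by
    unfold measChannel
    rw [ampl_sum]
    rfl
  rw [this]
  refine Matrix.posSemidef_sum _ fun k _ => Matrix.PosSemidef.submatrix ?_ _
  rw [ampl_conj]
  exact (hX.mul_mul_conjTranspose_same _).kronecker (regProj_posSemidef κ k)

lemma conj_kronecker_one_apply (L : Matrix n n ℂ) (Z : Matrix (n × r) (n × r) ℂ) (a a' : n)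
    (b b' : r) :
    ((L ⊗ₖ (1 : Matrix r r ℂ)) * Z * (L ⊗ₖ (1 : Matrix r r ℂ)).conjTranspose) (a, b) (a', b') =
      (L * (Matrix.of fun s t => Z (s, b) (t, b')) * L.conjTranspose) a a' := by
  simp only [Matrix.of_apply, Matrix.mul_apply, Fintype.sum_prod_type,
    Matrix.kroneckerMap_apply, Matrix.conjTranspose_apply, Matrix.one_apply,
    mul_ite, mul_one, mul_zero, ite_mul,
    zero_mul, Finset.sum_ite_eq, Finset.mem_univ,
    if_true, apply_ite star, star_zero]

end PositiveMaps

/-! ### Gentle measurement. -/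

section SharpBounds

set_option linter.unusedSectionVars false

variable {n : Type*} [Fintype n] [DecidableEq n]

/-- The difference equals ½[(F+P)ω(F-P)† + (F-P)ω(F+P)†]. Polarization writes it as AωA† - BωB†; the
free weight x balances the large operator F+P against the small F-P. -/
lemma traceBound_conj_sub_conj {ω : Matrix n n ℂ} (hω : ω.PosSemidef) (F P : Matrix n n ℂ)
    {x : ℝ} (hx : 0 < x) :
    TraceBound (F * ω * F.conjTranspose - P * ω * P.conjTranspose)
      (x * ((F * ω * F.conjTranspose).trace.re + (P * ω * P.conjTranspose).trace.re) +
        x⁻¹ / 2 * ((F - P) * ω * (F - P).conjTranspose).trace.re) := by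
  set s : ℝ := Real.sqrt x with hs
  have hs0 : 0 < s := Real.sqrt_pos.2 hx
  have hss : s * s = x := Real.mul_self_sqrt hx.le
  have hsc : (s : ℂ) ≠ 0 := by exact_mod_cast hs0.ne'
  set A : Matrix n n ℂ := ((s / 2 : ℝ) : ℂ) • (F + P) + ((s⁻¹ / 2 : ℝ) : ℂ) • (F - P) with hA
  set B : Matrix n n ℂ := ((s / 2 : ℝ) : ℂ) • (F + P) - ((s⁻¹ / 2 : ℝ) : ℂ) • (F - P) with hB
  refine ⟨A * ω * A.conjTranspose, B * ω * B.conjTranspose,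
    hω.mul_mul_conjTranspose_same _, hω.mul_mul_conjTranspose_same _, ?_, ?_⟩
  · simp only [hA, hB, Matrix.conjTranspose_add, Matrix.conjTranspose_sub,
      Matrix.conjTranspose_smul, Matrix.add_mul, Matrix.sub_mul, Matrix.mul_add, Matrix.mul_sub,
      Matrix.smul_mul, Matrix.mul_smul, Complex.star_def, Complex.conj_ofReal]
    push_cast
    match_scalars <;> field_simp <;> ring
  · have hd := (hω.mul_mul_conjTranspose_same (F - P)).re_trace_nonneg
    -- The parallelogram law replaces the trace for F+P by those for F and P; the resulting term
    -- with -x/2 has a favourable sign and is dropped.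
    have e : (A * ω * A.conjTranspose).trace.re + (B * ω * B.conjTranspose).trace.re =
        x * ((F * ω * F.conjTranspose).trace.re + (P * ω * P.conjTranspose).trace.re)
        + (x⁻¹ / 2 - x / 2) * ((F - P) * ω * (F - P).conjTranspose).trace.re := by
      simp only [hA, hB, Matrix.conjTranspose_add, Matrix.conjTranspose_sub,
        Matrix.conjTranspose_smul, Matrix.add_mul, Matrix.sub_mul, Matrix.mul_add, Matrix.mul_sub,
        Matrix.smul_mul, Matrix.mul_smul, Complex.star_def, Complex.conj_ofReal,
        Matrix.trace_add, Matrix.trace_sub, Matrix.trace_smul, smul_eq_mul, Complex.re_ofReal_mul,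
        Complex.add_re, Complex.sub_re]
      rw [← hss]
      field_simp
      ring
    rw [e]
    nlinarith

lemma re_trace_conj_sub_le {ω : Matrix n n ℂ} (hω : ω.PosSemidef) (A B : Matrix n n ℂ) :
    ((A - B) * ω * (A - B).conjTranspose).trace.re ≤
      2 * (A * ω * A.conjTranspose).trace.re + 2 * (B * ω * B.conjTranspose).trace.re := by
  have h := (hω.mul_mul_conjTranspose_same (A + B)).re_trace_nonneg
  simp only [Matrix.conjTranspose_add, Matrix.conjTranspose_sub, Matrix.add_mul, Matrix.sub_mul,
    Matrix.mul_add, Matrix.mul_sub, Matrix.trace_add, Matrix.trace_sub, Complex.add_re,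
    Complex.sub_re] at h ⊢
  linarith

/-- Gentle measurement: if the measurement operators `Fₖ` identify the states `Pₖ ω Pₖ` up to the
failure probability `x²`, then they act on `ω` almost as the projections `Pₖ`. -/
lemma gentle_measurement {ω : Matrix n n ℂ} (hω : IsState ω) {F P : Fin 2 → Matrix n n ℂ}
    (hF : ∀ k, (F k).conjTranspose = F k) (hFF : ∀ k, (F k - F k * F k).PosSemidef)
    (hF1 : F 0 * F 0 + F 1 * F 1 = 1) (hP : IsPVM P) {x : ℝ} (hx : 0 < x)
    (hfail : ((1 - F 0 * F 0) * (P 0 * ω * P 0)).trace.re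
      + ((1 - F 1 * F 1) * (P 1 * ω * P 1)).trace.re ≤ x ^ 2) :
    ∃ t : Fin 2 → ℝ, (∀ k, TraceBound
      (F k * ω * (F k).conjTranspose - P k * ω * (P k).conjTranspose) (t k)) ∧
        t 0 + t 1 ≤ 4 * x := by
  refine ⟨_, fun k => traceBound_conj_sub_conj hω.1 (F k) (P k) hx, ?_⟩
  have hPh : ∀ k, (P k).conjTranspose = P k := fun k => (hP.1 k).1.eq
  have tr1 : ∀ A : Matrix n n ℂ, A.conjTranspose = A →
      (A * ω * A.conjTranspose).trace.re = (A * A * ω).trace.re := fun A hA => by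
    rw [hA, Matrix.trace_mul_comm, ← Matrix.mul_assoc]
  have hsumF : (F 0 * ω * (F 0).conjTranspose).trace.re + (F 1 * ω * (F 1).conjTranspose).trace.re
      = 1 := by
    rw [tr1 _ (hF 0), tr1 _ (hF 1), ← Complex.add_re, ← Matrix.trace_add, ← Matrix.add_mul, hF1,
      Matrix.one_mul, hω.2, Complex.one_re]
  have hsumP : (P 0 * ω * (P 0).conjTranspose).trace.re + (P 1 * ω * (P 1).conjTranspose).trace.re
      = 1 := by
    rw [tr1 _ (hPh 0), tr1 _ (hPh 1), (hP.1 0).2, (hP.1 1).2, ← Complex.add_re,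
      ← Matrix.trace_add, ← Matrix.add_mul, hP.2, Matrix.one_mul, hω.2, Complex.one_re]
  have hω' : ∀ k, (P k * ω * P k).PosSemidef := fun k => by
    have := hω.1.mul_mul_conjTranspose_same (P k)
    rwa [hPh] at this
  have hD : ∀ j k : Fin 2, P j + P k = 1 → F j * F j + F k * F k = 1 →
      ((F j - P j) * ω * (F j - P j).conjTranspose).trace.re ≤
        2 * ((1 - F k * F k) * (P k * ω * P k)).trace.re
        + 2 * ((1 - F j * F j) * (P j * ω * P j)).trace.re := by
    intro j k hjk hFjk
    -- Two kinds of error: F_j responds on the range of P_k, or fails to respond on the range of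
    -- P_j. The first has weight F_j² = 1 - F_k², the second (1-F_j)² ≤ 1 - F_j² because F_j² ≤ F_j;
    -- both are failure terms.
    have e : F j - P j = F j * P k - (1 - F j) * P j := by
      calc F j - P j = F j * (P j + P k) - P j := by rw [hjk, Matrix.mul_one]
        _ = _ := by rw [Matrix.mul_add, Matrix.sub_mul, Matrix.one_mul]; abel
    rw [e]
    refine (re_trace_conj_sub_le hω.1 _ _).trans ?_
    have e1 : (F j * P k * ω * (F j * P k).conjTranspose).trace
        = ((1 - F k * F k) * (P k * ω * P k)).trace := by
      rw [← hFjk, add_sub_cancel_right, Matrix.conjTranspose_mul, hF, hPh, ← Matrix.mul_assoc,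
        Matrix.trace_mul_comm]
      simp only [Matrix.mul_assoc]
    have e2 : ((1 - F j) * P j * ω * ((1 - F j) * P j).conjTranspose).trace.re
        = ((1 - F j * F j) * (P j * ω * P j)).trace.re
          - 2 * ((F j - F j * F j) * (P j * ω * P j)).trace.re := by
      have e3 : ((1 - F j) * P j * ω * ((1 - F j) * P j).conjTranspose).trace
        = ((1 - F j) * (1 - F j) * (P j * ω * P j)).trace := by
        rw [Matrix.conjTranspose_mul, hPh, Matrix.conjTranspose_sub, hF, Matrix.conjTranspose_one,
          ← Matrix.mul_assoc, Matrix.trace_mul_comm]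
        simp only [Matrix.mul_assoc]
      have e4 : (1 - F j) * (1 - F j) = (1 - F j * F j) - (2 : ℂ) • (F j - F j * F j) := by
        rw [two_smul]; noncomm_ring
      rw [e3, e4, Matrix.sub_mul, Matrix.trace_sub, Matrix.smul_mul, Matrix.trace_smul]
      simp
    have h5 := (hFF j).re_trace_mul_nonneg (hω' j)
    rw [e1, e2]
    linarith
  have h0 := hD 0 1 hP.2 hF1
  have h1 := hD 1 0 (by rw [add_comm, hP.2]) (by rw [add_comm, hF1])
  -- The traces contribute x(1 + 1) = 2x. The two squared distances add up to at most 4x² and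
  -- contribute (x⁻¹/2)·4x² = 2x.
  have hxx : x⁻¹ * x ^ 2 = x := by field_simp
  have hx' : 0 < x⁻¹ := inv_pos.2 hx
  nlinarith

end SharpBounds

/-! ### One round of the protocol. -/

section Protocol

set_option linter.unusedSectionVars false

/-- The relabeling `(cb)a ≃ c(ab)`. -/
def rotEquiv (c b a : Type*) : (c × b) × a ≃ c × (a × b) :=
  (Equiv.prodAssoc c b a).trans ((Equiv.refl c).prodCongr (Equiv.prodComm b a))

/-- The relabeling `(cb)(ak) ≃ (ck)(ab)`. -/
def regEquiv (c b a k : Type*) : (c × b) × (a × k) ≃ (c × k) × (a × b) :=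
  (Equiv.prodAssoc c b (a × k)).trans
    (((Equiv.refl c).prodCongr (((Equiv.prodComm b (a × k)).trans
      ((Equiv.prodComm a k).prodCongr (Equiv.refl b))).trans (Equiv.prodAssoc k a b))).trans
        (Equiv.prodAssoc c k (a × b)).symm)

/-- The relabeling `(ck)(ab) ≃ (c(ak))b`. -/
def copyEquiv (c k a b : Type*) : (c × k) × (a × b) ≃ (c × (a × k)) × b :=
  (Equiv.prodAssoc c k (a × b)).trans
    (((Equiv.refl c).prodCongr ((Equiv.prodAssoc k a b).symm.trans
      ((Equiv.prodComm k a).prodCongr (Equiv.refl b)))).trans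
        (Equiv.prodAssoc c (a × k) b).symm)

variable {c a b a' b' k : Type*} [Fintype c] [DecidableEq c] [Fintype a] [DecidableEq a]
  [Fintype b] [DecidableEq b] [Fintype a'] [DecidableEq a'] [Fintype b'] [DecidableEq b']
  [Fintype k] [DecidableEq k]

/-- One round of the protocol: adjoin `σ`, apply `V`, measure with the operators `L`, undo `V`. -/
def protocolRound (V : Matrix (a' × b') (a × b) ℂ) (σ : Matrix a a ℂ)
    (κ : OrthonormalBasis (Fin 2) ℂ (EuclideanSpace ℂ k)) (L : Fin 2 → Matrix a' a' ℂ)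
    (X : Matrix (c × b) (c × b) ℂ) : Matrix ((c × (a × k)) × b) ((c × (a × k)) × b) ℂ :=
  (ampl (c × k)
    (fun Y : Matrix (a' × b') (a' × b') ℂ =>
      V.conjTranspose * Y * V.conjTranspose.conjTranspose)
    ((ampl (c × b') (measChannel κ L)
      ((ampl c (fun Y : Matrix (a × b) (a × b) ℂ => V * Y * V.conjTranspose)
        ((X ⊗ₖ σ).submatrix (rotEquiv c b a).symm (rotEquiv c b a).symm)).submatrix
          (rotEquiv c b' a') (rotEquiv c b' a'))).submatrix
            (regEquiv c b' a' k).symm (regEquiv c b' a' k).symm)).submatrix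
              (copyEquiv c k a b).symm (copyEquiv c k a b).symm

lemma isPositiveTP_protocolRound {V : Matrix (a' × b') (a × b) ℂ}
    (hV : V.conjTranspose * V = 1) (hV' : V * V.conjTranspose = 1) {σ : Matrix a a ℂ}
    (hσ : IsState σ) (κ : OrthonormalBasis (Fin 2) ℂ (EuclideanSpace ℂ k))
    {L : Fin 2 → Matrix a' a' ℂ} (hL : ∑ j, (L j).conjTranspose * L j = 1) :
    IsPositiveTP (protocolRound (c := c) V σ κ L) :=
  (isPositiveTP_submatrix _).comp <| (isPositiveTP_ampl_conj (V := V.conjTranspose)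
    (by rw [Matrix.conjTranspose_conjTranspose, hV'])).comp <|
    (isPositiveTP_submatrix _).comp <| (isPositiveTP_ampl_measChannel κ hL).comp <|
    (isPositiveTP_submatrix _).comp <| (isPositiveTP_ampl_conj hV).comp <|
    (isPositiveTP_submatrix _).comp <| isPositiveTP_kronecker hσ

lemma conj_smul (V : Matrix b a ℂ) (z : ℂ) (Y : Matrix a a ℂ) :
    V * (z • Y) * V.conjTranspose = z • (V * Y * V.conjTranspose) := by
  simp

/-- On a product input the j-th term is F_j(σ ⊗ η)F_j† with F_j = V†(L_j ⊗ 1)V, ready for comparison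
with the ideal output term by term. -/
lemma protocolRound_kronecker (V : Matrix (a' × b') (a × b) ℂ) (σ : Matrix a a ℂ)
    (κ : OrthonormalBasis (Fin 2) ℂ (EuclideanSpace ℂ k)) (L : Fin 2 → Matrix a' a' ℂ)
    (T : Matrix c c ℂ) (η : Matrix b b ℂ) :
    protocolRound V σ κ L (T ⊗ₖ η) = ∑ j, ((T ⊗ₖ regProj κ j) ⊗ₖ
      (V.conjTranspose * ((L j ⊗ₖ (1 : Matrix b' b' ℂ)) * (V * (σ ⊗ₖ η) * V.conjTranspose) *
        (L j ⊗ₖ (1 : Matrix b' b' ℂ)).conjTranspose) * V.conjTranspose.conjTranspose)).submatrix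
          (copyEquiv c k a b).symm (copyEquiv c k a b).symm := by
  have h1 : ((T ⊗ₖ η) ⊗ₖ σ).submatrix (rotEquiv c b a).symm (rotEquiv c b a).symm
      = T ⊗ₖ (σ ⊗ₖ η) := by
    ext ⟨i, s, t⟩ ⟨i', s', t'⟩
    simp [rotEquiv]; ring
  rw [protocolRound, h1, ampl_kronecker (conj_smul V)]
  set Z := V * (σ ⊗ₖ η) * V.conjTranspose
  have h2 : (ampl (c × b') (measChannel κ L) ((T ⊗ₖ Z).submatrix
      (rotEquiv c b' a') (rotEquiv c b' a'))).submatrix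
        (regEquiv c b' a' k).symm (regEquiv c b' a' k).symm
      = ∑ j, (T ⊗ₖ regProj κ j) ⊗ₖ ((L j ⊗ₖ (1 : Matrix b' b' ℂ)) * Z *
        (L j ⊗ₖ (1 : Matrix b' b' ℂ)).conjTranspose) := by
    ext ⟨⟨i, s⟩, α, β⟩ ⟨⟨i', s'⟩, α', β'⟩
    have : (Matrix.of fun u v => (T ⊗ₖ Z) (i, (u, β)) (i', (v, β')) : Matrix a' a' ℂ)
        = T i i' • Matrix.of fun u v => Z (u, β) (v, β') := rfl
    change measChannel κ L (Matrix.of fun u v => (T ⊗ₖ Z) (i, (u, β)) (i', (v, β')))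
      (α, s) (α', s') = _
    rw [this, measChannel_smul, measChannel, Matrix.smul_apply, Matrix.sum_apply, Finset.smul_sum,
      Matrix.sum_apply]
    refine Finset.sum_congr rfl fun j _ => ?_
    change _ = T i i' * regProj κ j s s' * ((L j ⊗ₖ (1 : Matrix b' b' ℂ)) * Z *
        (L j ⊗ₖ (1 : Matrix b' b' ℂ)).conjTranspose) (α, β) (α', β')
    rw [conj_kronecker_one_apply, Matrix.kroneckerMap_apply, smul_eq_mul]
    ring
  rw [h2]
  have h3 : ∀ (Φ : Matrix (a' × b') (a' × b') ℂ → Matrix (a × b) (a × b) ℂ)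
      (_ : ∀ X Y, Φ (X + Y) = Φ X + Φ Y) (X Y : Matrix ((c × k) × (a' × b')) _ ℂ),
      ampl (c × k) Φ (X + Y) = ampl (c × k) Φ X + ampl (c × k) Φ Y := fun Φ hΦ X Y => by
    ext i j
    exact congrFun₂ (hΦ _ _) i.2 j.2
  rw [Fin.sum_univ_two, h3 _ (fun X Y => by rw [Matrix.mul_add, Matrix.add_mul]),
    ampl_kronecker (conj_smul _), ampl_kronecker (conj_smul _), Fin.sum_univ_two]
  rfl

/-- Gives the ideal output the shape of `protocolRound_kronecker`, with P_j ⊗ 1 in place of F_j. -/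
lemma kronecker_measChannel_kronecker (σ : Matrix a a ℂ)
    (κ : OrthonormalBasis (Fin 2) ℂ (EuclideanSpace ℂ k)) (P : Fin 2 → Matrix a a ℂ)
    (T : Matrix c c ℂ) (η : Matrix b b ℂ) :
    (T ⊗ₖ measChannel κ P σ) ⊗ₖ η = ∑ j, ((T ⊗ₖ regProj κ j) ⊗ₖ
      ((P j ⊗ₖ (1 : Matrix b b ℂ)) * (σ ⊗ₖ η) * (P j ⊗ₖ (1 : Matrix b b ℂ)).conjTranspose)
        ).submatrix (copyEquiv c k a b).symm (copyEquiv c k a b).symm := by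
  have h : ∀ j, (P j ⊗ₖ (1 : Matrix b b ℂ)) * (σ ⊗ₖ η) *
      (P j ⊗ₖ (1 : Matrix b b ℂ)).conjTranspose = (P j * σ * (P j).conjTranspose) ⊗ₖ η := by
    intro j
    rw [Matrix.conjTranspose_kronecker, ← Matrix.mul_kronecker_mul, ← Matrix.mul_kronecker_mul]
    simp
  simp only [h]
  ext ⟨⟨i, s, u⟩, t⟩ ⟨⟨i', s', u'⟩, t'⟩
  simp only [measChannel, copyEquiv, Matrix.sum_apply, Matrix.submatrix_apply,
    Matrix.kroneckerMap_apply, Finset.mul_sum, Finset.sum_mul]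
  refine Finset.sum_congr rfl fun j _ => ?_
  simp
  ring

lemma sub_kronecker (X Y : Matrix a a ℂ) (Z : Matrix b b ℂ) :
    (X - Y) ⊗ₖ Z = X ⊗ₖ Z - Y ⊗ₖ Z := by
  ext ⟨i, j⟩ ⟨i', j'⟩
  simp [sub_mul]

lemma isPVM_kronecker_one {P : Fin 2 → Matrix a a ℂ} (hP : IsPVM P) :
    IsPVM fun j => P j ⊗ₖ (1 : Matrix b b ℂ) := by
  refine ⟨fun j => ⟨?_, ?_⟩, ?_⟩
  · rw [Matrix.IsHermitian, Matrix.conjTranspose_kronecker, (hP.1 j).1.eq,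
      Matrix.conjTranspose_one]
  · rw [← Matrix.mul_kronecker_mul, (hP.1 j).2, Matrix.one_mul]
  · rw [← Matrix.add_kronecker, hP.2, Matrix.one_kronecker_one]

open scoped Matrix.Norms.L2Operator in
lemma sqrt_le_one_of_le_one {Q : Matrix a a ℂ} (hQ1 : Q ≤ 1) : CFC.sqrt Q ≤ 1 := by
  have h := CFC.sqrt_le_sqrt Q 1 hQ1
  rwa [CFC.sqrt_one] at h

/-- With L = √Q ≤ 1 by operator monotonicity of the root, L - L² = √L (1 - L) √L. -/
lemma Matrix.PosSemidef.sqrt_sub_posSemidef {Q : Matrix a a ℂ} (hQ : Q.PosSemidef)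
    (hQ1 : (1 - Q).PosSemidef) : (CFC.sqrt Q - Q).PosSemidef := by
  have hle : CFC.sqrt Q ≤ 1 := sqrt_le_one_of_le_one (Matrix.le_iff.2 hQ1)
  set L := CFC.sqrt Q with hL
  have hLp : L.PosSemidef := Matrix.PosSemidef.sqrt_posSemidef Q
  have hs := hLp.sqrt_mul_sqrt
  have e : L - Q = CFC.sqrt L * (1 - L) * (CFC.sqrt L).conjTranspose := by
    rw [Matrix.conjTranspose_sqrt, Matrix.mul_sub, Matrix.mul_one, Matrix.sub_mul, hs,
      ← hQ.sqrt_mul_sqrt, ← hL]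
    congr 1
    calc L * L = CFC.sqrt L * CFC.sqrt L * (CFC.sqrt L * CFC.sqrt L) := by rw [hs]
      _ = CFC.sqrt L * (CFC.sqrt L * CFC.sqrt L) * CFC.sqrt L := by
        simp only [Matrix.mul_assoc]
      _ = _ := by rw [hs]
  rw [e]
  exact (Matrix.le_iff.1 hle).mul_mul_conjTranspose_same _

lemma IsPOVM.one_sub_posSemidef {Q : Fin 2 → Matrix a a ℂ} (hQ : IsPOVM Q) (j : Fin 2) :
    (1 - Q j).PosSemidef := by
  rw [← hQ.2]
  fin_cases j
  · simpa using hQ.1 1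
  · simpa using hQ.1 0

lemma IsPOVM.sum_sqrt {Q : Fin 2 → Matrix a a ℂ} (hQ : IsPOVM Q) :
    ∑ j, (CFC.sqrt (Q j)).conjTranspose * CFC.sqrt (Q j) = 1 := by
  simp only [Matrix.conjTranspose_sqrt, (hQ.1 _).sqrt_mul_sqrt, Fin.sum_univ_two, hQ.2]

lemma IsPVM.sum_conjTranspose_mul {P : Fin 2 → Matrix a a ℂ} (hP : IsPVM P) :
    ∑ j, (P j).conjTranspose * P j = 1 := by
  simp only [(hP.1 _).1.eq, (hP.1 _).2, Fin.sum_univ_two, hP.2]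

/-- On product states one round of the protocol simulates the measurement of the PVM `P` on `σ` and
returns the ancilla, up to an error controlled by the failure probability. -/
lemma protocolRound_traceBound {V : Matrix (a' × b') (a × b) ℂ}
    (hV : V.conjTranspose * V = 1) (hV' : V * V.conjTranspose = 1)
    {σ : Matrix a a ℂ} (hσ : IsState σ) {η : Matrix b b ℂ} (hη : IsState η) {T : Matrix c c ℂ}
    (hT : IsState T) (κ : OrthonormalBasis (Fin 2) ℂ (EuclideanSpace ℂ k))
    {Q : Fin 2 → Matrix a' a' ℂ} (hQ : IsPOVM Q) {P : Fin 2 → Matrix a a ℂ} (hP : IsPVM P)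
    {p : ℝ} {ρ : Fin 2 → Matrix a a ℂ}
    (hPσ : ∀ j, P j * σ * (P j).conjTranspose = ((prior p j : ℝ) : ℂ) • ρ j) {x : ℝ} (hx : 0 < x)
    (hfail : failProb p (fun j => partialTrace (V * (ρ j ⊗ₖ η) * V.conjTranspose)) Q ≤ x ^ 2) :
    TraceBound (protocolRound V σ κ (fun j => CFC.sqrt (Q j)) (T ⊗ₖ η)
      - (T ⊗ₖ measChannel κ P σ) ⊗ₖ η) (4 * x) := by
  set L : Fin 2 → Matrix a' a' ℂ := fun j => CFC.sqrt (Q j) with hL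
  have hLh : ∀ j, (L j).conjTranspose = L j := fun j => Matrix.conjTranspose_sqrt _
  have hLL : ∀ j, L j * L j = Q j := fun j => (hQ.1 j).sqrt_mul_sqrt
  set F : Fin 2 → Matrix (a × b) (a × b) ℂ := fun j =>
    V.conjTranspose * (L j ⊗ₖ (1 : Matrix b' b' ℂ)) * V with hF
  set ω := σ ⊗ₖ η with hω
  have hωs : IsState ω := (isPositiveTP_kronecker hη).isState hσ
  have hFh : ∀ j, (F j).conjTranspose = F j := fun j => by
    simp only [hF, Matrix.conjTranspose_mul, Matrix.conjTranspose_kronecker, hLh,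
      Matrix.conjTranspose_one, Matrix.conjTranspose_conjTranspose, Matrix.mul_assoc]
  have hFF : ∀ j, F j * F j = V.conjTranspose * (Q j ⊗ₖ (1 : Matrix b' b' ℂ)) * V := fun j => by
    calc F j * F j = V.conjTranspose * (L j ⊗ₖ (1 : Matrix b' b' ℂ)) * (V * V.conjTranspose) *
          (L j ⊗ₖ (1 : Matrix b' b' ℂ)) * V := by simp only [hF, Matrix.mul_assoc]
      _ = V.conjTranspose * ((L j ⊗ₖ (1 : Matrix b' b' ℂ)) *
          (L j ⊗ₖ (1 : Matrix b' b' ℂ))) * V := by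
            rw [hV', Matrix.mul_one, Matrix.mul_assoc V.conjTranspose]
      _ = _ := by rw [← Matrix.mul_kronecker_mul, hLL, Matrix.one_mul]
  have hFpos : ∀ j, (F j - F j * F j).PosSemidef := fun j => by
    have h1 := (((hQ.1 j).sqrt_sub_posSemidef (hQ.one_sub_posSemidef j)).kronecker
      (Matrix.PosSemidef.one (n := b') (R := ℂ))).conjTranspose_mul_mul_same V
    rwa [sub_kronecker, Matrix.mul_sub, Matrix.sub_mul, ← hFF] at h1
  have hFsum : F 0 * F 0 + F 1 * F 1 = 1 := by
    rw [hFF, hFF, ← Matrix.add_mul, ← Matrix.mul_add, ← Matrix.add_kronecker, hQ.2,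
      Matrix.one_kronecker_one, Matrix.mul_one, hV]
  -- Conjugation by V moves the test 1 - Q_j from A' back to AB, so the failure term of
  -- `gentle_measurement` is exactly the one in `failProb`.
  have hterm : ∀ j, ((1 - F j * F j) * ((P j ⊗ₖ (1 : Matrix b b ℂ)) * ω *
      (P j ⊗ₖ (1 : Matrix b b ℂ)))).trace.re = prior p j *
        ((1 - Q j) * partialTrace (V * (ρ j ⊗ₖ η) * V.conjTranspose)).trace.re := by
    intro j
    have e1 : (P j ⊗ₖ (1 : Matrix b b ℂ)) * ω * (P j ⊗ₖ (1 : Matrix b b ℂ))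
        = ((prior p j : ℝ) : ℂ) • (ρ j ⊗ₖ η) := by
      rw [← Matrix.smul_kronecker, ← hPσ, hω, ← Matrix.mul_kronecker_mul,
        ← Matrix.mul_kronecker_mul, (hP.1 j).1.eq]
      simp
    have e2 : 1 - F j * F j = V.conjTranspose * ((1 - Q j) ⊗ₖ (1 : Matrix b' b' ℂ)) * V := by
      have : (1 - Q j) ⊗ₖ (1 : Matrix b' b' ℂ) = 1 - Q j ⊗ₖ (1 : Matrix b' b' ℂ) := by
        rw [sub_kronecker, Matrix.one_kronecker_one]
      rw [hFF, this, Matrix.mul_sub, Matrix.sub_mul, Matrix.mul_one, hV]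
    rw [e1, e2, Matrix.mul_smul, Matrix.trace_smul, smul_eq_mul, Complex.re_ofReal_mul,
      trace_mul_partialTrace, Matrix.mul_assoc, Matrix.mul_assoc, Matrix.trace_mul_comm,
      Matrix.mul_assoc]
  have hfail' : ((1 - F 0 * F 0) * ((P 0 ⊗ₖ (1 : Matrix b b ℂ)) * ω *
      (P 0 ⊗ₖ (1 : Matrix b b ℂ)))).trace.re + ((1 - F 1 * F 1) *
        ((P 1 ⊗ₖ (1 : Matrix b b ℂ)) * ω * (P 1 ⊗ₖ (1 : Matrix b b ℂ)))).trace.re ≤ x ^ 2 := by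
    rw [hterm, hterm]
    simpa only [failProb, Fin.sum_univ_two] using hfail
  obtain ⟨t, ht, hts⟩ := gentle_measurement hωs hFh hFpos hFsum
    (isPVM_kronecker_one (b := b) hP) hx hfail'
  have hFω : ∀ j, V.conjTranspose * ((L j ⊗ₖ (1 : Matrix b' b' ℂ)) *
      (V * ω * V.conjTranspose) * (L j ⊗ₖ (1 : Matrix b' b' ℂ)).conjTranspose) *
        V.conjTranspose.conjTranspose = F j * ω * (F j).conjTranspose := fun j => by
    simp only [hF, Matrix.conjTranspose_mul, Matrix.mul_assoc]
  rw [protocolRound_kronecker, kronecker_measChannel_kronecker, ← Finset.sum_sub_distrib,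
    Fin.sum_univ_two]
  have hj : ∀ j, TraceBound
      ((((T ⊗ₖ regProj κ j) ⊗ₖ (F j * ω * (F j).conjTranspose)).submatrix
          (copyEquiv c k a b).symm (copyEquiv c k a b).symm) -
      ((T ⊗ₖ regProj κ j) ⊗ₖ ((P j ⊗ₖ (1 : Matrix b b ℂ)) * ω *
        (P j ⊗ₖ (1 : Matrix b b ℂ)).conjTranspose)).submatrix
          (copyEquiv c k a b).symm (copyEquiv c k a b).symm) (t j) := fun j => by
    have h1 := ((ht j).kronecker ((isPositiveTP_kronecker (regProj_isState κ j)).isState hT)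
      ).submatrix (copyEquiv c k a b).symm
    convert h1 using 1
    ext i i'
    simp [mul_sub]
  simp only [← hω, hFω]
  exact ((hj 0).add (hj 1)).mono hts

end Protocol

variable {E : Type u} {d : E → ℕ+}

/-! ### Resource accounting for the repeated protocol. -/

section Systems

open Sys

lemma rearrangement_rotEquiv (C B A : Sys d) :
    Rearrangement (S := (C ⊠ B) ⊠ A) (T := C ⊠ (A ⊠ B)) (rotEquiv C.idx B.idx A.idx) :=
  (Rearrangement.assoc C B A).trans ((Rearrangement.refl C).congr (.comm B A))

lemma rearrangement_regEquiv (C B A K : Sys d) :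
    Rearrangement (S := (C ⊠ B) ⊠ (A ⊠ K)) (T := (C ⊠ K) ⊠ (A ⊠ B))
      (regEquiv C.idx B.idx A.idx K.idx) :=
  (Rearrangement.assoc C B (A ⊠ K)).trans
    (((Rearrangement.refl C).congr (((Rearrangement.comm B (A ⊠ K)).trans
      ((Rearrangement.comm A K).congr (.refl B))).trans (.assoc K A B))).trans
        (Rearrangement.assoc C K (A ⊠ B)).symm)

lemma rearrangement_copyEquiv (C K A B : Sys d) :
    Rearrangement (S := (C ⊠ K) ⊠ (A ⊠ B)) (T := (C ⊠ (A ⊠ K)) ⊠ B)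
      (copyEquiv C.idx K.idx A.idx B.idx) :=
  (Rearrangement.assoc C K (A ⊠ B)).trans
    (((Rearrangement.refl C).congr ((Rearrangement.assoc K A B).symm.trans
      ((Rearrangement.comm K A).congr (.refl B)))).trans
        (Rearrangement.assoc C (A ⊠ K) B).symm)

variable {𝓕 : FreeSets d} {M : ∀ S : Sys d, Op S → ℝ} {h : HolderData d}

lemma isState_one_unit : IsState (1 : Op (Sys.unit : Sys d)) :=
  ⟨Matrix.PosSemidef.one, by simp [Matrix.trace_one]⟩

lemma isState_tensorPow {S : Sys d} {ρ : Op S} (hρ : IsState ρ) :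
    ∀ m, IsState (tensorPow ρ m)
  | 0 => isState_one_unit
  | m + 1 => (isPositiveTP_kronecker hρ).isState (isState_tensorPow hρ m)

/-- Two trivial systems are one up to rearrangement, so additivity makes the value its own double.
-/
lemma IsResourceMeasure.unit_eq_zero (hM : IsResourceMeasure 𝓕 M h) :
    M Sys.unit (1 : Op (Sys.unit : Sys d)) = 0 := by
  have h1 := hM.additive _ _ _ _ (isState_one_unit (d := d)) isState_one_unit
  have h2 := hM.rearrange _ _ _ (Rearrangement.unitRight (Sys.unit : Sys d))
    ((1 : Op (Sys.unit : Sys d)) ⊗ₖ (1 : Op (Sys.unit : Sys d)))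
    ((isPositiveTP_kronecker isState_one_unit).isState isState_one_unit)
  have h3 : ((1 : Op (Sys.unit : Sys d)) ⊗ₖ (1 : Op (Sys.unit : Sys d))).submatrix
      (Equiv.prodPUnit (Sys.unit : Sys d).idx).symm (Equiv.prodPUnit (Sys.unit : Sys d).idx).symm
      = (1 : Op (Sys.unit : Sys d)) := by
    ext i j
    simp
  rw [h3] at h2
  linarith

/-- Tracing out ρ leaves the trivial system, where M vanishes. -/
lemma IsResourceMeasure.nonneg (hM : IsResourceMeasure 𝓕 M h) {S : Sys d} {ρ : Op S}
    (hρ : IsState ρ) : 0 ≤ M S ρ := by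
  have h1 := hM.mono_partialTrace Sys.unit S ((1 : Op (Sys.unit : Sys d)) ⊗ₖ ρ)
    ((isPositiveTP_kronecker hρ).isState isState_one_unit)
  have h2 : partialTrace ((1 : Op (Sys.unit : Sys d)) ⊗ₖ ρ) = 1 := by
    ext i j
    have : ∑ k, ρ k k = 1 := hρ.2
    simp [partialTrace, this]
  rw [h2, hM.unit_eq_zero, hM.additive _ _ _ _ isState_one_unit hρ, hM.unit_eq_zero] at h1
  linarith

/-- On (0,2] the function c stays below cmax, and it tends to 0. -/
lemma IsResourceMeasure.cmax_nonneg (hM : IsResourceMeasure 𝓕 M h) : 0 ≤ h.cmax := by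
  refine le_of_tendsto hM.c_tendsto ?_
  have : Set.Ioc (0 : ℝ) 2 ∈ 𝓝[>] (0 : ℝ) := Ioc_mem_nhdsGT (by norm_num)
  filter_upwards [this] with x hx
  exact hM.c_le x ⟨hx.1.le, hx.2⟩

lemma HolderData.growth_nonneg (h : HolderData d) (S : Sys d) (m : ℕ) : 0 ≤ h.growth S m := by
  rw [HolderData.growth]; split_ifs <;> positivity

/-- The resource measure after one round of the protocol. -/
lemma IsResourceMeasure.protocolRound_le (hM : IsResourceMeasure 𝓕 M h) {A B A' B' K C : Sys d}
    {V : Matrix (A' ⊠ B').idx (A ⊠ B).idx ℂ} (hV : V ∈ 𝓕.freeUnitary (A ⊠ B) (A' ⊠ B'))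
    {σ : Op A} (hσ : IsState σ) (κ : OrthonormalBasis (Fin 2) ℂ (EuclideanSpace ℂ K.idx))
    {L : Fin 2 → Op A'} (hL : ∑ j, (L j).conjTranspose * L j = 1) {q : ℝ}
    (hq : ∀ (R : Sys d) (ω : Op (R ⊠ A')), IsState ω →
      M (R ⊠ (A' ⊠ K)) (ampl R.idx (measChannel κ L) ω) - M (R ⊠ A') ω ≤ q)
    {ω : Op (C ⊠ B)} (hω : IsState ω) :
    M ((C ⊠ (A ⊠ K)) ⊠ B) (protocolRound V σ κ L ω) ≤ M (C ⊠ B) ω + (M A σ + q) := by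
  obtain ⟨hVV, hVV'⟩ := 𝓕.isUnitary _ _ V hV
  set X1 : Op ((C ⊠ B) ⊠ A) := ω ⊗ₖ σ with hX1
  have s1 : IsState X1 := (isPositiveTP_kronecker hσ).isState hω
  have m1 : M _ X1 = M _ ω + M _ σ := hM.additive _ _ _ _ hω hσ
  set X2 : Op (C ⊠ (A ⊠ B)) := X1.submatrix (rotEquiv C.idx B.idx A.idx).symm
    (rotEquiv C.idx B.idx A.idx).symm with hX2
  have s2 : IsState X2 := (isPositiveTP_submatrix _).isState s1
  have m2 : M _ X2 = M _ X1 := hM.rearrange _ _ _ (rearrangement_rotEquiv C B A) X1 s1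
  set X3 : Op (C ⊠ (A' ⊠ B')) := conjRight C V X2 with hX3
  have s3 : IsState X3 := (isPositiveTP_ampl_conj hVV).isState s2
  have m3 : M _ X3 ≤ M _ X2 := hM.mono_unitary _ _ _ V hV X2 s2
  set X4 : Op ((C ⊠ B') ⊠ A') := X3.submatrix (rotEquiv C.idx B'.idx A'.idx)
    (rotEquiv C.idx B'.idx A'.idx) with hX4
  have s4 : IsState X4 := (isPositiveTP_submatrix _).isState s3
  have m4 : M _ X4 = M _ X3 := hM.rearrange _ _ _ (rearrangement_rotEquiv C B' A').symm X3 s3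
  set X5 : Op ((C ⊠ B') ⊠ (A' ⊠ K)) := ampl (C ⊠ B').idx (measChannel κ L) X4 with hX5
  have s5 : IsState X5 := (isPositiveTP_ampl_measChannel κ hL).isState s4
  have m5 : M _ X5 - M _ X4 ≤ q := hq _ _ s4
  set X6 : Op ((C ⊠ K) ⊠ (A' ⊠ B')) := X5.submatrix (regEquiv C.idx B'.idx A'.idx K.idx).symm
    (regEquiv C.idx B'.idx A'.idx K.idx).symm with hX6
  have s6 : IsState X6 := (isPositiveTP_submatrix _).isState s5
  have m6 : M _ X6 = M _ X5 := hM.rearrange _ _ _ (rearrangement_regEquiv C B' A' K) X5 s5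
  set X7 : Op ((C ⊠ K) ⊠ (A ⊠ B)) := conjRight (C ⊠ K) V.conjTranspose X6 with hX7
  have s7 : IsState X7 := (isPositiveTP_ampl_conj
    (by rw [Matrix.conjTranspose_conjTranspose]; exact hVV')).isState s6
  have m7 : M _ X7 ≤ M _ X6 := hM.mono_dual _ _ _ V hV X6 s6
  have m8 := hM.rearrange _ _ _ (rearrangement_copyEquiv C K A B) X7 s7
  have e : protocolRound V σ κ L ω = X7.submatrix (copyEquiv C.idx K.idx A.idx B.idx).symm
    (copyEquiv C.idx K.idx A.idx B.idx).symm := rfl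
  rw [e]
  linarith

/-- The protocol that reuses one ancilla to simulate a measurement on `m` copies. -/
lemma IsResourceMeasure.exists_protocol (hM : IsResourceMeasure 𝓕 M h) {A B A' B' K : Sys d}
    {V : Matrix (A' ⊠ B').idx (A ⊠ B).idx ℂ} (hV : V ∈ 𝓕.freeUnitary (A ⊠ B) (A' ⊠ B'))
    {σ : Op A} (hσ : IsState σ) {η : Op B} (hη : IsState η)
    (κ : OrthonormalBasis (Fin 2) ℂ (EuclideanSpace ℂ K.idx))
    {Q : Fin 2 → Op A'} (hQ : IsPOVM Q) {P : Fin 2 → Op A} (hP : IsPVM P) {q : ℝ}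
    (hq : ∀ (R : Sys d) (ω : Op (R ⊠ A')), IsState ω →
      M (R ⊠ (A' ⊠ K)) (ampl R.idx (measChannel κ fun j => CFC.sqrt (Q j)) ω)
        - M (R ⊠ A') ω ≤ q)
    {p : ℝ} {ρ : Fin 2 → Op A}
    (hPσ : ∀ j, P j * σ * (P j).conjTranspose = ((prior p j : ℝ) : ℂ) • ρ j) (m : ℕ) :
    ∃ ω : Op ((A ⊠ K).copies m ⊠ B), IsState ω ∧
      M ((A ⊠ K).copies m ⊠ B) ω ≤ M B η + m * (M A σ + q) ∧
      ∀ x : ℝ, 0 < x → failProb p (fun j => implemented η V (ρ j)) Q ≤ x ^ 2 →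
        TraceBound (ω - tensorPow (S := A ⊠ K) (measChannel κ P σ) m ⊗ₖ η) (m * (4 * x)) := by
  obtain ⟨hVV, hVV'⟩ := 𝓕.isUnitary _ _ V hV
  have hτ : IsState (measChannel κ P σ) :=
    (isPositiveTP_measChannel κ hP.sum_conjTranspose_mul).isState hσ
  induction m with
  | zero =>
    refine ⟨(1 : Op (Sys.unit : Sys d)) ⊗ₖ η,
      (isPositiveTP_kronecker hη).isState isState_one_unit, ?_, fun x _ _ => ?_⟩
    · have := hM.additive _ _ _ _ (isState_one_unit (d := d)) hη
      rw [hM.unit_eq_zero] at this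
      exact this.le.trans (by simp)
    · change TraceBound ((1 : Op (Sys.unit : Sys d)) ⊗ₖ η - (1 : Op (Sys.unit : Sys d)) ⊗ₖ η) _
      rw [sub_self]
      simpa using TraceBound.zero
  | succ m ih =>
    obtain ⟨ω, hω, hMω, hT⟩ := ih
    have hr : IsPositiveTP (protocolRound (c := ((A ⊠ K).copies m).idx) V σ κ
      fun j => CFC.sqrt (Q j)) := isPositiveTP_protocolRound hVV hVV' hσ κ hQ.sum_sqrt
    refine ⟨protocolRound V σ κ (fun j => CFC.sqrt (Q j)) ω, hr.isState hω, ?_,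
      fun x hx hf => ?_⟩
    · refine (hM.protocolRound_le hV hσ κ hQ.sum_sqrt hq hω).trans ?_
      push_cast
      linarith
    -- Compare through the round applied to the ideal product τ^{⊗m} ⊗ η: the old error is not
    -- amplified, and the new one is at most 4x.
    · have h1 := hr.traceBound (hT x hx hf)
      rw [hr.map_sub] at h1
      have h2 := protocolRound_traceBound hVV hVV' hσ hη
        (isState_tensorPow (S := A ⊠ K) hτ m) κ hQ hP hPσ hx hf
      have h3 := h1.add h2
      rw [sub_add_sub_cancel] at h3
      refine TraceBound.mono h3 ?_
      push_cast
      linarith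

lemma partialTrace_kronecker {n m : Type*} [Fintype n] [Fintype m] (X : Matrix n n ℂ)
    {η : Matrix m m ℂ} (hη : IsState η) : partialTrace (X ⊗ₖ η) = X := by
  ext i j
  have : ∑ k, η k k = 1 := hη.2
  simp [partialTrace, ← Finset.mul_sum, this]

/-- The cost of `m` simulated measurements. -/
lemma IsResourceMeasure.mul_gain_le (hM : IsResourceMeasure 𝓕 M h) {A B A' B' K : Sys d}
    {V : Matrix (A' ⊠ B').idx (A ⊠ B).idx ℂ} (hV : V ∈ 𝓕.freeUnitary (A ⊠ B) (A' ⊠ B'))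
    {σ : Op A} (hσ : IsState σ) {η : Op B} (hη : IsState η)
    (κ : OrthonormalBasis (Fin 2) ℂ (EuclideanSpace ℂ K.idx))
    {Q : Fin 2 → Op A'} (hQ : IsPOVM Q) {P : Fin 2 → Op A} (hP : IsPVM P) {q : ℝ}
    (hq : ∀ (R : Sys d) (ω : Op (R ⊠ A')), IsState ω →
      M (R ⊠ (A' ⊠ K)) (ampl R.idx (measChannel κ fun j => CFC.sqrt (Q j)) ω)
        - M (R ⊠ A') ω ≤ q)
    {p : ℝ} {ρ : Fin 2 → Op A}
    (hPσ : ∀ j, P j * σ * (P j).conjTranspose = ((prior p j : ℝ) : ℂ) • ρ j)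
    {x : ℝ} (hx : 0 ≤ x) (hfail : failProb p (fun j => implemented η V (ρ j)) Q ≤ x ^ 2)
    {m : ℕ} (hm : 1 ≤ m) :
    m * (M (A ⊠ K) (measChannel κ P σ) - M A σ - q) ≤
      M B η + h.growth (A ⊠ K) m * h.K (A ⊠ K) * (m * (4 * x)) ^ h.b (A ⊠ K) + h.cmax := by
  have hτ : IsState (measChannel κ P σ) :=
    (isPositiveTP_measChannel κ hP.sum_conjTranspose_mul).isState hσ
  obtain ⟨ω, hω, hMω, hT⟩ := hM.exists_protocol hV hσ hη κ hQ hP hq hPσ m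
  set τ : Op (A ⊠ K) := measChannel κ P σ with hτd
  have hpt := isPositiveTP_partialTrace (n := ((A ⊠ K).copies m).idx) (m := B.idx)
  have hω' : IsState (partialTrace ω) := hpt.isState hω
  have hτm := isState_tensorPow (S := A ⊠ K) hτ m
  set ε := traceNorm (tensorPow (S := A ⊠ K) τ m - partialTrace ω) with hε
  have hε0 : 0 ≤ ε := traceNorm_nonneg _
  have hε2 : ε ≤ 2 := (TraceBound.sub_of_isState hτm hω').traceNorm_le
  have hεx : ε ≤ m * (4 * x) := by
    -- `gentle_measurement` needs a positive parameter, but x = 0 is the case of divergence. The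
    -- protocol's output does not depend on the parameter, so y may decrease to x.
    have key : ∀ y, x < y → ε ≤ m * (4 * y) := fun y hy => by
      have h1 := hpt.traceBound (hT y (hx.trans_lt hy)
        (hfail.trans (pow_le_pow_left₀ hx hy.le 2)))
      rw [hpt.map_sub, partialTrace_kronecker _ hη] at h1
      obtain ⟨X, Y, hX, hY, e, ht⟩ := h1
      exact TraceBound.traceNorm_le ⟨Y, X, hY, hX, by rw [← neg_sub, e, neg_sub], by linarith⟩
    have hlim : Filter.Tendsto (fun y : ℝ => (m : ℝ) * (4 * y)) (𝓝[>] x) (𝓝 (m * (4 * x))) :=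
      (Continuous.tendsto (by fun_prop) x).mono_left nhdsWithin_le_nhds
    exact ge_of_tendsto hlim (Filter.mem_of_superset self_mem_nhdsWithin key)
  have hH := hM.holder (A ⊠ K) m hm τ (partialTrace ω) hτ hω'
  rw [← hε] at hH
  have hMτ : M _ (tensorPow (S := A ⊠ K) τ m) = m * M (A ⊠ K) τ := by
    clear hH hεx hε2 hε0 hε hτm hω' hpt hT hMω hω hm
    clear ε ω
    induction m with
    | zero => exact hM.unit_eq_zero.trans (by simp)
    | succ m ih =>
      have := hM.additive _ _ _ _ (isState_tensorPow (S := A ⊠ K) hτ m) hτ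
      refine this.trans ?_
      rw [ih]
      push_cast
      ring
  have hpart := hM.mono_partialTrace _ _ ω hω
  have hc := hM.c_le ε ⟨hε0, hε2⟩
  have hpow : ε ^ h.b (A ⊠ K) ≤ (m * (4 * x)) ^ h.b (A ⊠ K) :=
    Real.rpow_le_rpow hε0 hεx (hM.b_pos _).le
  have hK := mul_le_mul_of_nonneg_left hpow
    (mul_nonneg (h.growth_nonneg (A ⊠ K) m) (hM.K_nonneg (A ⊠ K)))
  have habs := (abs_le.1 hH).2
  rw [hMτ] at habs
  linarith

end Systems

/-! ### Optimization over the number of rounds. -/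

section RealBounds

/-- The maximum of `mγ - C mˢ` over the natural numbers, up to `γ`. -/
lemma le_of_forall_nat_mul_le_rpow {γ C s μ : ℝ} (hγ : 0 < γ) (hC : 0 < C) (hs : 1 < s)
    (h : ∀ m : ℕ, m * γ ≤ μ + C * (m : ℝ) ^ s) :
    (γ / (s * C)) ^ (1 / (s - 1)) * γ * (1 - 1 / s) - γ ≤ μ := by
  -- The real maximizer, where γ = sC t^(s-1) and hence C t^s = tγ/s. Rounding it down to a natural
  -- number loses at most γ.
  set t := (γ / (s * C)) ^ (1 / (s - 1)) with ht
  have hs0 : 0 < s := by linarith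
  have ht0 : 0 < t := by positivity
  have h1 := h ⌊t⌋₊
  have h2 : t - 1 ≤ (⌊t⌋₊ : ℝ) := (Nat.sub_one_lt_floor t).le
  have h3 : (⌊t⌋₊ : ℝ) ^ s ≤ t ^ s :=
    Real.rpow_le_rpow (Nat.cast_nonneg _) (Nat.floor_le ht0.le) hs0.le
  have h4 : t ^ s = t * (γ / (s * C)) := by
    have : t ^ s = t ^ (1 : ℝ) * t ^ (s - 1) := by
      rw [← Real.rpow_add ht0]; congr 1; ring
    rw [this, Real.rpow_one]
    congr 1
    rw [ht, ← Real.rpow_mul (by positivity), one_div_mul_cancel (by linarith), Real.rpow_one]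
  have h5 : C * t ^ s = t * γ * (1 / s) := by
    rw [h4]; field_simp
  have h6 := mul_le_mul_of_nonneg_left h3 hC.le
  have h7 := mul_le_mul_of_nonneg_right h2 hγ.le
  linarith

/-- The maximum of `mγ - C exp (s m)` over the natural numbers, up to `γ`. -/
lemma le_of_forall_nat_mul_le_exp {γ C s μ : ℝ} (hγ : 0 < γ) (hC : 0 < C) (hs : 0 < s)
    (hμ : 0 ≤ μ) (h : ∀ m : ℕ, m * γ ≤ μ + C * Real.exp (s * m)) :
    γ * (1 / s) * Real.log (γ / (C * s)) - γ * (1 + 1 / s) ≤ μ := by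
  set t := 1 / s * Real.log (γ / (C * s)) with ht
  rcases lt_or_ge t 0 with h0 | h0
  -- A negative maximizer cannot be rounded down to a number of rounds, but then the bound is
  -- nonpositive.
  · have h1 : γ * t ≤ 0 := mul_nonpos_of_nonneg_of_nonpos hγ.le h0.le
    have h2 : 0 ≤ γ * (1 + 1 / s) := by positivity
    rw [mul_assoc]
    linarith
  · have h1 := h ⌊t⌋₊
    have h2 : t - 1 ≤ (⌊t⌋₊ : ℝ) := (Nat.sub_one_lt_floor t).le
    have h3 : Real.exp (s * ⌊t⌋₊) ≤ Real.exp (s * t) :=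
      Real.exp_le_exp.2 (mul_le_mul_of_nonneg_left (Nat.floor_le h0) hs.le)
    have h4 : Real.exp (s * t) = γ / (C * s) := by
      rw [ht, ← mul_assoc, mul_one_div_cancel hs.ne', one_mul, Real.exp_log (by positivity)]
    have h5 : C * Real.exp (s * t) = γ * (1 / s) := by
      rw [h4]; field_simp
    have h6 := mul_le_mul_of_nonneg_left h3 hC.le
    have h7 := mul_le_mul_of_nonneg_right h2 hγ.le
    rw [mul_assoc]
    linarith

lemma false_of_forall_nat_mul_le {γ μ : ℝ} (hγ : 0 < γ) (h : ∀ m : ℕ, m * γ ≤ μ) : False := by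
  obtain ⟨m, hm⟩ := exists_nat_gt (μ / γ)
  rw [div_lt_iff₀ hγ] at hm
  linarith [h m]

lemma fErr_nonneg {x : ℝ} (hx : 0 ≤ x) : 0 ≤ fErr x := by unfold fErr; positivity

lemma four_mul_le_fErr (x : ℝ) : 4 * x ≤ fErr x := by
  unfold fErr; linarith [sq_nonneg x]

variable {a a' b K cmax γ μ x : ℝ}

/-- The Hölder term is at most C m^(a+b) with C = K f(x)^b, since 4x ≤ f(x). If G > 0, the case C =
0 contradicts the hypothesis for large m, which is why the value ∞ of the quotient does no harm. -/
lemma powerBound_le (ha : 0 < a) (hb : 0 < b) (hab : 1 < a + b) (hK : 0 ≤ K) (hc : 0 ≤ cmax)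
    (hγ : 0 ≤ γ) (hμ : 0 ≤ μ) (hx : 0 ≤ x)
    (h : ∀ m : ℕ, m * γ ≤ μ + (m : ℝ) ^ a * K * (m * (4 * x)) ^ b + cmax) :
    powerBound a b K cmax (ENNReal.ofReal γ) x ≤ (μ : EReal) := by
  have hs1 : 0 < a + b - 1 := by linarith
  have hf := fErr_nonneg hx
  set C := K * fErr x ^ b with hCd
  have hC0 : 0 ≤ C := by positivity
  have h' : ∀ m : ℕ, m * γ ≤ (μ + cmax) + C * (m : ℝ) ^ (a + b) := fun m => by
    have e : (m : ℝ) ^ a * K * (m * (4 * x)) ^ b ≤ C * (m : ℝ) ^ (a + b) := by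
      calc (m : ℝ) ^ a * K * (m * (4 * x)) ^ b
          ≤ (m : ℝ) ^ a * K * (m * fErr x) ^ b := by
            gcongr
            exact four_mul_le_fErr x
        _ = _ := by
          rw [Real.mul_rpow (Nat.cast_nonneg _) hf,
            Real.rpow_add_of_nonneg (Nat.cast_nonneg _) ha.le hb.le]
          ring
    linarith [h m]
  rw [powerBound, ← hCd]
  rcases hγ.eq_or_lt with h0 | h0
  · rw [← h0, ENNReal.ofReal_zero, ENNReal.zero_rpow_of_pos (by positivity), ENNReal.zero_div,
      mul_zero]
    have : (-cmax : ℝ) ≤ μ := by linarith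
    simpa using (EReal.coe_le_coe_iff.2 this)
  rcases hC0.eq_or_lt with hC | hC
  · refine (false_of_forall_nat_mul_le h0 (μ := μ + cmax) fun m => ?_).elim
    simpa [← hC] using h' m
  have key := le_of_forall_nat_mul_le_rpow h0 hC hab h'
  have hg : 0 ≤ gConst a b := by
    have : 1 / (a + b) ≤ 1 := by rw [div_le_one (by linarith)]; exact hab.le
    exact mul_nonneg (by positivity) (by linarith)
  have e : (γ / ((a + b) * C)) ^ (1 / (a + b - 1)) * γ * (1 - 1 / (a + b))
      = gConst a b * (γ ^ ((a + b) / (a + b - 1)) / C ^ (1 / (a + b - 1))) := by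
    have e1 : γ ^ ((a + b) / (a + b - 1)) = γ ^ (1 / (a + b - 1)) * γ := by
      have : (a + b) / (a + b - 1) = 1 / (a + b - 1) + 1 := by field_simp; ring
      rw [this, Real.rpow_add h0, Real.rpow_one]
    have e2 : γ / ((a + b) * C) = 1 / (a + b) * (γ / C) := by field_simp
    rw [e1, e2, Real.mul_rpow (by positivity) (by positivity), Real.div_rpow h0.le hC0, gConst]
    ring
  rw [e] at key
  rw [ENNReal.ofReal_rpow_of_pos h0, ENNReal.ofReal_rpow_of_pos hC,
    ← ENNReal.ofReal_div_of_pos (by positivity), ← ENNReal.ofReal_mul hg,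
    EReal.coe_ennreal_ofReal, EReal.coe_ennreal_ofReal, max_eq_left (by positivity),
    max_eq_left hγ, ← EReal.coe_sub, ← EReal.coe_sub, EReal.coe_le_coe_iff]
  linarith

/-- The factor m^b is absorbed by m ≤ e^m, which turns the exponent a' into a' + b. -/
lemma logBound_le (hb : 0 < b) (hab : 0 < a' + b) (hK : 0 ≤ K) (hc : 0 ≤ cmax)
    (hγ : 0 ≤ γ) (hμ : 0 ≤ μ) (hx : 0 ≤ x)
    (h : ∀ m : ℕ, m * γ ≤ μ + Real.exp (a' * m) * K * (m * (4 * x)) ^ b + cmax) :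
    logBound a' b K cmax (ENNReal.ofReal γ) x ≤ (μ : EReal) := by
  have hf := fErr_nonneg hx
  set C := K * fErr x ^ b with hCd
  have hC0 : 0 ≤ C := by positivity
  have h' : ∀ m : ℕ, m * γ ≤ (μ + cmax) + C * Real.exp ((a' + b) * m) := fun m => by
    have e : Real.exp (a' * m) * K * (m * (4 * x)) ^ b ≤ C * Real.exp ((a' + b) * m) := by
      calc Real.exp (a' * m) * K * (m * (4 * x)) ^ b
          ≤ Real.exp (a' * m) * K * (Real.exp m * fErr x) ^ b := by
            gcongr
            · linarith [Real.add_one_le_exp (m : ℝ)]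
            · exact four_mul_le_fErr x
        _ = _ := by
          rw [Real.mul_rpow (Real.exp_pos _).le hf, ← Real.exp_mul, add_mul, Real.exp_add,
            mul_comm b]
          ring
    linarith [h m]
  rw [logBound, ← hCd]
  rcases hγ.eq_or_lt with h0 | h0
  · rw [← h0, ENNReal.ofReal_zero, EReal.coe_ennreal_zero, zero_mul, zero_mul, zero_mul]
    have : (-cmax : ℝ) ≤ μ := by linarith
    simpa using (EReal.coe_le_coe_iff.2 this)
  rcases hC0.eq_or_lt with hC | hC
  · refine (false_of_forall_nat_mul_le h0 (μ := μ + cmax) fun m => ?_).elim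
    simpa [← hC] using h' m
  have key := le_of_forall_nat_mul_le_exp h0 hC hab (by linarith) h'
  rw [← ENNReal.ofReal_div_of_pos (by positivity), ENNReal.log_ofReal_of_pos (by positivity),
    EReal.coe_ennreal_ofReal, max_eq_left hγ, ← EReal.coe_mul, ← EReal.coe_mul, ← EReal.coe_mul,
    ← EReal.coe_sub, ← EReal.coe_sub, EReal.coe_le_coe_iff]
  linarith

lemma linearBound_le (hK : 0 ≤ K) (hc : 0 ≤ cmax) (hγ : 0 ≤ γ) (hμ : 0 ≤ μ) (hx : 0 ≤ x)
    (h : ∀ m : ℕ, m * γ ≤ μ + (m : ℝ) * K * (m * (4 * x)) + cmax) :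
    linearBound K cmax (ENNReal.ofReal γ) x ≤ (μ : EReal) := by
  rw [linearBound]
  rcases hγ.eq_or_lt with h0 | h0
  · rw [← h0]
    have : (-cmax : ℝ) ≤ μ := by linarith
    simpa using (EReal.coe_le_coe_iff.2 this)
  rcases hK.eq_or_lt with hK0 | hK0
  -- For K = 0 the subtracted term G²/(64K) is ∞ as well, and ∞ - ∞ is -∞ in `EReal`.
  · have : ENNReal.ofReal γ ^ 2 / 0 = ⊤ := ENNReal.div_zero (by simpa using h0)
    simp [← hK0, this]
  rcases hx.eq_or_lt with hx0 | hx0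
  · refine (false_of_forall_nat_mul_le h0 (μ := μ + cmax) fun m => ?_).elim
    simpa [← hx0] using h m
  -- The maximum of mγ - Cm² is γ²/(4C), which is γ²/(16Kx) for C = 4Kx. The term γ²/(64K) is mere
  -- slack.
  have key := le_of_forall_nat_mul_le_rpow h0 (C := 4 * K * x) (s := 2) (μ := μ + cmax)
    (by positivity) (by norm_num) fun m => by
      rw [Real.rpow_two]
      linarith [h m]
  have e : (γ / (2 * (4 * K * x))) ^ (1 / ((2 : ℝ) - 1)) * γ * (1 - 1 / 2)
      = γ ^ 2 / (16 * K * x) := by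
    norm_num
    field_simp
    norm_num
  rw [e] at key
  rw [← ENNReal.ofReal_pow hγ, ← ENNReal.ofReal_div_of_pos (by positivity),
    ← ENNReal.ofReal_div_of_pos (by positivity), EReal.coe_ennreal_ofReal,
    EReal.coe_ennreal_ofReal, EReal.coe_ennreal_ofReal, max_eq_left (by positivity),
    max_eq_left hγ, max_eq_left (by positivity), ← EReal.coe_add, ← EReal.coe_add,
    ← EReal.coe_sub, EReal.coe_le_coe_iff]
  have : 0 ≤ γ ^ 2 / (64 * K) := by positivity
  linarith

end RealBounds

/-! ### Failure probabilities from recovery errors and implementation errors. -/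

section Discrimination

set_option linter.unusedSectionVars false

variable {n m : Type*} [Fintype n] [DecidableEq n] [Fintype m] [DecidableEq m]

lemma prior_nonneg {p : ℝ} (hp : p ∈ Set.Icc (0 : ℝ) 1) (k : Fin 2) : 0 ≤ prior p k := by
  fin_cases k
  · exact hp.1
  · exact sub_nonneg.2 hp.2

lemma sum_prior (p : ℝ) : ∑ k, prior p k = 1 := by
  simp [prior]

/-- The identification of the system with itself amplified by a one-dimensional reference. -/
def oneRef (n : Type*) : Fin 1 × n ≃ n := Equiv.uniqueProd n (Fin 1)

lemma ampl_oneRef (Φ : Matrix n n ℂ → Matrix m m ℂ) (X : Matrix n n ℂ) :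
    ampl (Fin 1) Φ (X.submatrix (oneRef n) (oneRef n)) = (Φ X).submatrix (oneRef m) (oneRef m) :=
  rfl

lemma IsChannel.isPositiveTP {Φ : Matrix n n ℂ →ₗ[ℂ] Matrix m m ℂ} (hΦ : IsChannel Φ) :
    IsPositiveTP Φ := by
  refine ⟨fun X Y => _root_.map_sub Φ X Y, fun X hX => ?_, hΦ.tracePreserving⟩
  have h := hΦ.completelyPositive 1 _ (hX.submatrix (oneRef n))
  rw [ampl_oneRef] at h
  exact h.submatrix (oneRef m).symm

lemma posSemidef_of_forall_nonneg {Q : Matrix n n ℂ}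
    (h : ∀ x : n → ℂ, 0 ≤ star x ⬝ᵥ Q.mulVec x) : Q.PosSemidef := by
  rw [← Matrix.isPositive_toEuclideanLin_iff, LinearMap.isPositive_iff_complex]
  intro x
  have e : inner ℂ (Matrix.toEuclideanLin Q x) x = star (star x.ofLp ⬝ᵥ Q.mulVec x.ofLp) := by
    rw [EuclideanSpace.inner_eq_star_dotProduct, Matrix.star_dotProduct, dotProduct_comm]
    simp [Matrix.toLpLin_apply]
  have h1 := Complex.le_def.1 (h x.ofLp)
  rw [e]
  refine ⟨Complex.ext ?_ ?_, ?_⟩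
  · simp
  · simpa using h1.2.symm
  · simpa using h1.1

/-- The adjoint of Φ for the trace pairing, read off from the matrix units. -/
lemma exists_dual_matrix (Φ : Matrix m m ℂ →ₗ[ℂ] Matrix n n ℂ) (Q : Matrix n n ℂ) :
    ∃ Q' : Matrix m m ℂ, ∀ X, (Q' * X).trace = (Q * Φ X).trace := by
  refine ⟨Matrix.of fun i j => (Q * Φ (Matrix.single j i 1)).trace, fun X => ?_⟩
  have hX : Φ X = ∑ i, ∑ j, X i j • Φ (Matrix.single i j 1) := by
    conv_lhs => rw [Matrix.matrix_eq_sum_single X]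
    simp only [map_sum]
    refine Finset.sum_congr rfl fun i _ => Finset.sum_congr rfl fun j _ => ?_
    rw [← map_smul]
    congr 1
    simp [Matrix.smul_single]
  have hQX : (Q * Φ X).trace = ∑ i, ∑ j, X i j * (Q * Φ (Matrix.single i j 1)).trace := by
    rw [hX]
    simp only [Finset.mul_sum, Matrix.trace_sum, Matrix.mul_smul, Matrix.trace_smul, smul_eq_mul]
  rw [hQX, Finset.sum_comm]
  exact Finset.sum_congr rfl fun i _ => Matrix.mul_apply.trans
    (Finset.sum_congr rfl fun j _ => mul_comm _ _)

/-- The adjoint of a positive trace-preserving map is positive and unital, so it carries POVMs to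
POVMs. -/
lemma exists_dual_isPOVM {Φ : Matrix m m ℂ →ₗ[ℂ] Matrix n n ℂ} (hΦ : IsPositiveTP Φ)
    {P : Fin 2 → Matrix n n ℂ} (hP : IsPOVM P) :
    ∃ Q : Fin 2 → Matrix m m ℂ, IsPOVM Q ∧ ∀ k X, (Q k * X).trace = (P k * Φ X).trace := by
  choose Q hQ using fun k => exists_dual_matrix Φ (P k)
  refine ⟨Q, ⟨fun k => posSemidef_of_forall_nonneg fun x => ?_, ?_⟩, hQ⟩
  · have e : star x ⬝ᵥ (Q k).mulVec x = (Q k * Matrix.vecMulVec x (star x)).trace := by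
      rw [Matrix.mul_vecMulVec, Matrix.trace_vecMulVec, dotProduct_comm]
    rw [e, hQ]
    have h1 := hΦ.psd _ (Matrix.posSemidef_vecMulVec_self_star x)
    have h2 := h1.mul_mul_conjTranspose_same (CFC.sqrt (P k))
    rw [Matrix.conjTranspose_sqrt] at h2
    have e2 : (CFC.sqrt (P k) * Φ (Matrix.vecMulVec x (star x)) * CFC.sqrt (P k)).trace
        = (P k * Φ (Matrix.vecMulVec x (star x))).trace := by
      rw [Matrix.trace_mul_comm, ← Matrix.mul_assoc, (hP.1 k).sqrt_mul_sqrt]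
    rw [← e2]
    exact h2.trace_nonneg
  · rw [Matrix.ext_iff_trace_mul_right]
    intro X
    rw [Matrix.add_mul, Matrix.trace_add, hQ, hQ, ← Matrix.trace_add, ← Matrix.add_mul, hP.2,
      Matrix.one_mul, Matrix.one_mul, hΦ.trace]

lemma IsPVM.isPOVM {P : Fin 2 → Matrix n n ℂ} (hP : IsPVM P) : IsPOVM P := by
  refine ⟨fun k => ?_, hP.2⟩
  have h := Matrix.posSemidef_conjTranspose_mul_self (P k)
  rwa [(hP.1 k).1.eq, (hP.1 k).2] at h

lemma re_trace_one_sub_mul {Q ρ : Matrix n n ℂ} (hρ : IsState ρ) :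
    ((1 - Q) * ρ).trace.re = 1 - (Q * ρ).trace.re := by
  rw [Matrix.sub_mul, Matrix.trace_sub, Matrix.one_mul, hρ.2]; simp

/-- An optimal discrimination of `(Λ(ρ₁),Λ(ρ₂))_p` fails with probability at most `δ²`. -/
lemma failProb_le_irreversibility_sq {Λ : Matrix n n ℂ →ₗ[ℂ] Matrix m m ℂ} (hΛ : IsChannel Λ)
    {ρ : Fin 2 → Matrix n n ℂ} (hρ : ∀ k, IsState (ρ k)) {p : ℝ} (hp : p ∈ Set.Icc (0 : ℝ) 1)
    {P : Fin 2 → Matrix n n ℂ} (hP : IsPVM P) (hPρ : ∀ k, (P k * ρ k).trace = 1)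
    {Q : Fin 2 → Matrix m m ℂ}
    (hQ : ∀ Q' : Fin 2 → Matrix m m ℂ, IsPOVM Q' →
      failProb p (fun k => Λ (ρ k)) Q ≤ failProb p (fun k => Λ (ρ k)) Q') :
    failProb p (fun k => Λ (ρ k)) Q ≤ irreversibility Λ p ρ ^ 2 := by
  set s := {x | ∃ 𝓡 : Matrix m m ℂ →ₗ[ℂ] Matrix n n ℂ, IsChannel 𝓡 ∧
    x = ∑ k, prior p k * purifiedDist (ρ k) (𝓡 (Λ (ρ k))) ^ 2} with hs
  have hs0 : ∀ x ∈ s, 0 ≤ x := by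
    rintro x ⟨𝓡, -, rfl⟩
    exact Finset.sum_nonneg fun k _ => mul_nonneg (prior_nonneg hp k) (sq_nonneg _)
  -- The real infimum of the empty set would be 0 by default; the channel that always prepares ρ 0
  -- excludes this.
  have hne : s.Nonempty := by
    let 𝓡 : Matrix m m ℂ →ₗ[ℂ] Matrix n n ℂ :=
      { toFun := fun X => X.trace • ρ 0
        map_add' := fun X Y => by rw [Matrix.trace_add, add_smul]
        map_smul' := fun c X => by rw [Matrix.trace_smul, smul_eq_mul, mul_smul]; rfl }
    refine ⟨_, 𝓡, ⟨fun k X hX => ?_, fun X => ?_⟩, rfl⟩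
    · have e : ampl (Fin k) 𝓡 X = partialTrace X ⊗ₖ ρ 0 := rfl
      rw [e]
      exact (isPositiveTP_partialTrace.psd X hX).kronecker (hρ 0).1
    · change (X.trace • ρ 0).trace = _
      rw [Matrix.trace_smul, (hρ 0).2, smul_eq_mul, mul_one]
  have e : irreversibility Λ p ρ ^ 2 = sInf s := by
    rw [irreversibility, Real.sq_sqrt (Real.sInf_nonneg hs0)]
  rw [e]
  refine le_csInf hne ?_
  rintro x ⟨𝓡, h𝓡, rfl⟩
  obtain ⟨Q', hQ', hd⟩ := exists_dual_isPOVM h𝓡.isPositiveTP hP.isPOVM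
  refine (hQ Q' hQ').trans (Finset.sum_le_sum fun k _ =>
    mul_le_mul_of_nonneg_left ?_ (prior_nonneg hp k))
  have hΛρ := hΛ.isPositiveTP.isState (hρ k)
  have h1 := fidelity_sq_le (hρ k) (h𝓡.isPositiveTP.isState hΛρ).1 (hP.isPOVM.1 k)
    (hP.isPOVM.one_sub_posSemidef k) (by rw [hPρ]; rfl)
  have h2 := one_sub_fidelity_sq_le (ρ k) (𝓡 (Λ (ρ k)))
  rw [re_trace_one_sub_mul hΛρ, hd]
  linarith

lemma purifiedDist_oneRef_le_channelDist (Φ Ψ : Matrix n n ℂ → Matrix m m ℂ) {ρ : Matrix n n ℂ}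
    (hρ : IsState ρ) : purifiedDist ((Φ ρ).submatrix (oneRef m) (oneRef m))
      ((Ψ ρ).submatrix (oneRef m) (oneRef m)) ≤ channelDist Φ Ψ := by
  refine le_csSup ⟨1, ?_⟩ ⟨1, ρ.submatrix (oneRef n) (oneRef n),
    (isPositiveTP_submatrix _).isState hρ, rfl⟩
  rintro x ⟨k, σ, -, rfl⟩
  exact purifiedDist_le_one _ _

lemma eq_of_channelDist_le_zero {Φ Ψ : Matrix n n ℂ → Matrix m m ℂ} (hΦ : IsPositiveTP Φ)
    (hΨ : IsPositiveTP Ψ) (h : channelDist Φ Ψ ≤ 0) {ρ : Matrix n n ℂ} (hρ : IsState ρ) :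
    Φ ρ = Ψ ρ := by
  have h1 := eq_of_purifiedDist_le_zero
    ((isPositiveTP_submatrix (oneRef m)).isState (hΦ.isState hρ))
    ((isPositiveTP_submatrix (oneRef m)).isState (hΨ.isState hρ))
    ((purifiedDist_oneRef_le_channelDist Φ Ψ hρ).trans h)
  exact congrArg (fun X => X.submatrix (oneRef m).symm (oneRef m).symm) h1

/-- If an effect is certain after `Φ`, it fails after `Ψ` with probability at most `ε²`. -/
lemma re_trace_one_sub_mul_le_of_channelDist_le {Φ Ψ : Matrix n n ℂ → Matrix m m ℂ}
    (hΦ : IsPositiveTP Φ) (hΨ : IsPositiveTP Ψ) {ε : ℝ} (h : channelDist Φ Ψ ≤ ε)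
    {ρ : Matrix n n ℂ} (hρ : IsState ρ) {Q : Matrix m m ℂ} (hQ : Q.PosSemidef)
    (hQ1 : (1 - Q).PosSemidef) (h1 : ((1 - Q) * Φ ρ).trace.re = 0) :
    ((1 - Q) * Ψ ρ).trace.re ≤ ε ^ 2 := by
  have hΦρ := hΦ.isState hρ
  have hΨρ := hΨ.isState hρ
  have e : ∀ X : Matrix m m ℂ, (Q.submatrix (oneRef m) (oneRef m) *
      X.submatrix (oneRef m) (oneRef m)).trace = (Q * X).trace := fun X => by
    rw [Matrix.submatrix_mul_equiv, trace_submatrix_equiv]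
  rw [re_trace_one_sub_mul hΦρ] at h1
  have h2 := fidelity_sq_le ((isPositiveTP_submatrix (oneRef m)).isState hΦρ)
    ((isPositiveTP_submatrix (oneRef m)).isState hΨρ).1 (hQ.submatrix (oneRef m))
    (by
      have := hQ1.submatrix (oneRef m)
      rwa [Matrix.submatrix_sub, Pi.sub_apply, Pi.sub_apply, Matrix.submatrix_one_equiv] at this)
    (by rw [e]; linarith)
  have h3 := one_sub_fidelity_sq_le ((Φ ρ).submatrix (oneRef m) (oneRef m))
    ((Ψ ρ).submatrix (oneRef m) (oneRef m))
  have h4 := pow_le_pow_left₀ (purifiedDist_nonneg _ _)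
    ((purifiedDist_oneRef_le_channelDist Φ Ψ hρ).trans h) 2
  rw [e] at h2
  rw [re_trace_one_sub_mul hΨρ]
  linarith

/-- Zero failure after Φ means that each outcome has prior 0 or a certain effect; only the latter
can contribute after Ψ. -/
lemma failProb_le_of_channelDist_le {Φ Ψ : Matrix n n ℂ → Matrix m m ℂ}
    (hΦ : IsPositiveTP Φ) (hΨ : IsPositiveTP Ψ) {ε : ℝ} (h : channelDist Φ Ψ ≤ ε)
    {ρ : Fin 2 → Matrix n n ℂ} (hρ : ∀ k, IsState (ρ k)) {p : ℝ} (hp : p ∈ Set.Icc (0 : ℝ) 1)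
    {Q : Fin 2 → Matrix m m ℂ} (hQ : IsPOVM Q) (h0 : failProb p (fun k => Φ (ρ k)) Q ≤ 0) :
    failProb p (fun k => Ψ (ρ k)) Q ≤ ε ^ 2 := by
  have hnn : ∀ k ∈ (Finset.univ : Finset (Fin 2)),
      0 ≤ prior p k * ((1 - Q k) * Φ (ρ k)).trace.re := fun k _ =>
    mul_nonneg (prior_nonneg hp k)
      ((hQ.one_sub_posSemidef k).re_trace_mul_nonneg (hΦ.isState (hρ k)).1)
  have hz := (Finset.sum_eq_zero_iff_of_nonneg hnn).1
    (le_antisymm h0 (Finset.sum_nonneg hnn))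
  have hk : ∀ k, prior p k * ((1 - Q k) * Ψ (ρ k)).trace.re ≤ prior p k * ε ^ 2 := fun k => by
    rcases mul_eq_zero.1 (hz k (Finset.mem_univ k)) with h1 | h1
    · rw [h1, zero_mul, zero_mul]
    · exact mul_le_mul_of_nonneg_left (re_trace_one_sub_mul_le_of_channelDist_le hΦ hΨ h (hρ k)
        (hQ.1 k) (hQ.one_sub_posSemidef k) h1) (prior_nonneg hp k)
  refine (Finset.sum_le_sum fun k _ => hk k).trans ?_
  rw [← Finset.sum_mul, sum_prior, one_mul]

end Discrimination

/-! ### From the gap to lower bounds on the ancilla. -/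

section Cost

lemma isPositiveTP_implemented {A B A' B' : Sys d} {η : Op B} (hη : IsState η)
    {V : Matrix (A' ⊠ B').idx (A ⊠ B).idx ℂ} (hV : V.conjTranspose * V = 1) :
    IsPositiveTP (implemented η V : Op A → Op A') :=
  isPositiveTP_partialTrace.comp ((isPositiveTP_conj hV).comp (isPositiveTP_kronecker hη))

variable {𝓕 : FreeSets d} {M : ∀ S : Sys d, Op S → ℝ} {h : HolderData d}

/-- Witnesses for a lower bound on the gap. -/
lemma exists_of_lt_gap {A A' K : Sys d}
    {κ : OrthonormalBasis (Fin 2) ℂ (EuclideanSpace ℂ K.idx)} {Λ : Op A → Op A'} {p : ℝ}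
    {ρ : Fin 2 → Op A} {r : ℝ} (hr : ENNReal.ofReal r < gap M A A' K κ Λ p ρ) :
    ∃ (σ : Op A) (P : Fin 2 → Op A) (Q : Fin 2 → Op A') (q : ℝ), IsState σ ∧ IsPVM P ∧
      (∀ k, (P k * ρ k).trace = 1) ∧
      (∀ k, P k * σ * (P k).conjTranspose = ((prior p k : ℝ) : ℂ) • ρ k) ∧ IsPOVM Q ∧
      (∀ Q' : Fin 2 → Op A', IsPOVM Q' →
        failProb p (fun k => Λ (ρ k)) Q ≤ failProb p (fun k => Λ (ρ k)) Q') ∧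
      (∀ (R : Sys d) (ω : Op (R ⊠ A')), IsState ω →
        M (R ⊠ (A' ⊠ K)) (ampl R.idx (measChannel κ fun j => CFC.sqrt (Q j)) ω)
          - M (R ⊠ A') ω ≤ q) ∧
      M (A ⊠ K) (measChannel κ P σ) - M A σ - q = r := by
  have h1 : (r : EReal) < gainEm M A K κ p ρ - powerCos M A' K κ p fun k => Λ (ρ k) := by
    by_contra hcon
    have := EReal.toENNReal_le_toENNReal (not_lt.1 hcon)
    rw [EReal.toENNReal_of_ne_top (EReal.coe_ne_top r), EReal.toReal_coe] at this
    exact absurd hr (not_lt.2 this)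
  have h2 := EReal.add_lt_of_lt_sub h1
  rw [add_comm, ← EReal.lt_sub_iff_add_lt (Or.inl (EReal.coe_ne_bot r))
    (Or.inl (EReal.coe_ne_top r)), powerCos, sInf_lt_iff] at h2
  obtain ⟨y, ⟨Q, hQ, hopt, rfl⟩, hy⟩ := h2
  rw [EReal.lt_sub_iff_add_lt (Or.inl (EReal.coe_ne_bot r)) (Or.inl (EReal.coe_ne_top r)),
    gainEm, lt_sSup_iff] at hy
  obtain ⟨z, ⟨σ, P, hσ, hP, hPρ, hmeas, rfl⟩, hz⟩ := hy
  rw [← EReal.lt_sub_iff_add_lt (Or.inl (EReal.coe_ne_bot r)) (Or.inl (EReal.coe_ne_top r)),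
    ← EReal.coe_sub] at hz
  -- Here q is M(τ) - M(σ) - r, which exceeds the power of the measurement strictly. Thus neither
  -- optimum in the gap has to be attained.
  refine ⟨σ, P, Q, _, hσ, hP, hPρ, fun k => ?_, hQ, hopt, fun R ω hω => ?_, sub_sub_cancel _ r⟩
  · refine eq_of_sum_kronecker_regProj_eq κ (X := fun k => P k * σ * (P k).conjTranspose)
      (Y := fun k => ((prior p k : ℝ) : ℂ) • ρ k) ?_ k
    rw [measChannel] at hmeas
    simpa only [Matrix.smul_kronecker] using hmeas
  · have h3 := (le_iSup₂_of_le (f := fun (R : Sys d) (σ : Op (R ⊠ A')) => ⨆ (_ : IsState σ),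
      ((M (R ⊠ (A' ⊠ K)) (ampl R.idx (measChannel κ fun j => CFC.sqrt (Q j)) σ)
        - M (R ⊠ A') σ : ℝ) : EReal)) R ω (le_iSup_of_le hω le_rfl))
    exact (EReal.coe_lt_coe_iff.1 (lt_of_le_of_lt h3 hz)).le

/-- The cost of `m` simulated measurements in terms of the gap. -/
lemma IsResourceMeasure.gap_le (hM : IsResourceMeasure 𝓕 M h) {A A' K : Sys d}
    {κ : OrthonormalBasis (Fin 2) ℂ (EuclideanSpace ℂ K.idx)} {Λ : Op A → Op A'} {p : ℝ}
    {ρ : Fin 2 → Op A} {B B' : Sys d} {V : Matrix (A' ⊠ B').idx (A ⊠ B).idx ℂ}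
    (hV : V ∈ 𝓕.freeUnitary (A ⊠ B) (A' ⊠ B')) {η : Op B} (hη : IsState η) {x : ℝ} (hx : 0 ≤ x)
    (hfail : ∀ (P : Fin 2 → Op A) (Q : Fin 2 → Op A'), IsPVM P → (∀ k, (P k * ρ k).trace = 1) →
      IsPOVM Q → (∀ Q' : Fin 2 → Op A', IsPOVM Q' →
        failProb p (fun k => Λ (ρ k)) Q ≤ failProb p (fun k => Λ (ρ k)) Q') →
      failProb p (fun k => implemented η V (ρ k)) Q ≤ x ^ 2) :
    gap M A A' K κ Λ p ρ ≠ ∞ ∧ ∀ m : ℕ, m * (gap M A A' K κ Λ p ρ).toReal ≤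
      M B η + h.growth (A ⊠ K) m * h.K (A ⊠ K) * (m * (4 * x)) ^ h.b (A ⊠ K) + h.cmax := by
  have key : ∀ r : ℝ, ENNReal.ofReal r < gap M A A' K κ Λ p ρ → ∀ m : ℕ, 1 ≤ m → m * r ≤
      M B η + h.growth (A ⊠ K) m * h.K (A ⊠ K) * (m * (4 * x)) ^ h.b (A ⊠ K) + h.cmax := by
    intro r hr m hm
    obtain ⟨σ, P, Q, q, hσ, hP, hPρ, hPσ, hQ, hopt, hq, rfl⟩ := exists_of_lt_gap hr
    exact hM.mul_gain_le hV hσ hη κ hQ hP hq hPσ hx (hfail P Q hP hPρ hQ hopt) hm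
  have hrhs : ∀ m : ℕ, 0 ≤ M B η + h.growth (A ⊠ K) m * h.K (A ⊠ K) *
      (m * (4 * x)) ^ h.b (A ⊠ K) + h.cmax := fun m => by
    have h1 := hM.nonneg hη
    have h2 := hM.cmax_nonneg
    have h3 := h.growth_nonneg (A ⊠ K) m
    have h4 := hM.K_nonneg (A ⊠ K)
    positivity
  have htop : gap M A A' K κ Λ p ρ ≠ ∞ := by
    intro hG
    have h1 := key (M B η + h.growth (A ⊠ K) (1 : ℕ) * h.K (A ⊠ K) *
      (((1 : ℕ) : ℝ) * (4 * x)) ^ h.b (A ⊠ K) + h.cmax + 1)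
      (by rw [hG]; exact ENNReal.ofReal_lt_top) 1 le_rfl
    rw [Nat.cast_one, one_mul] at h1
    linarith
  refine ⟨htop, fun m => ?_⟩
  rcases Nat.eq_zero_or_pos m with rfl | hm
  · simpa using hrhs 0
  have hm0 : (0 : ℝ) < m := Nat.cast_pos.2 hm
  rw [← le_div_iff₀' hm0]
  refine le_of_forall_lt_imp_le_of_dense fun r hr => ?_
  rw [le_div_iff₀' hm0]
  rcases lt_or_ge r 0 with h0 | h0
  · exact (mul_nonpos_of_nonneg_of_nonpos hm0.le h0.le).trans (hrhs m)
  · exact key r ((ENNReal.ofReal_lt_iff_lt_toReal h0 htop).2 hr) m hm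

/-- The lower bounds on the resource of an ancilla that implements `Λ`. -/
lemma IsResourceMeasure.bounds_le (hM : IsResourceMeasure 𝓕 M h) {A A' K : Sys d}
    {κ : OrthonormalBasis (Fin 2) ℂ (EuclideanSpace ℂ K.idx)} {Λ : Op A → Op A'} {p : ℝ}
    {ρ : Fin 2 → Op A} {B B' : Sys d} {V : Matrix (A' ⊠ B').idx (A ⊠ B).idx ℂ}
    (hV : V ∈ 𝓕.freeUnitary (A ⊠ B) (A' ⊠ B')) {η : Op B} (hη : IsState η) {x : ℝ} (hx : 0 ≤ x)
    (hfail : ∀ (P : Fin 2 → Op A) (Q : Fin 2 → Op A'), IsPVM P → (∀ k, (P k * ρ k).trace = 1) →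
      IsPOVM Q → (∀ Q' : Fin 2 → Op A', IsPOVM Q' →
        failProb p (fun k => Λ (ρ k)) Q ≤ failProb p (fun k => Λ (ρ k)) Q') →
      failProb p (fun k => implemented η V (ρ k)) Q ≤ x ^ 2) :
    (h.a (A ⊠ K) ≠ ∞ →
      powerBound (h.a (A ⊠ K)).toReal (h.b (A ⊠ K)) (h.K (A ⊠ K)) h.cmax
        (gap M A A' K κ Λ p ρ) x ≤ (M B η : EReal)) ∧
    (h.a (A ⊠ K) = ∞ →
      logBound (h.a' (A ⊠ K)) (h.b (A ⊠ K)) (h.K (A ⊠ K)) h.cmax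
        (gap M A A' K κ Λ p ρ) x ≤ (M B η : EReal)) ∧
    (h.a (A ⊠ K) = 1 → h.b (A ⊠ K) = 1 →
      linearBound (h.K (A ⊠ K)) h.cmax (gap M A A' K κ Λ p ρ) x ≤ (M B η : EReal)) := by
  obtain ⟨htop, hm⟩ := hM.gap_le hV hη hx hfail
  have hγ : 0 ≤ (gap M A A' K κ Λ p ρ).toReal := ENNReal.toReal_nonneg
  rw [← ENNReal.ofReal_toReal htop]
  have hK := hM.K_nonneg (A ⊠ K)
  have hb := hM.b_pos (A ⊠ K)
  have hc := hM.cmax_nonneg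
  have hμ := hM.nonneg hη
  refine ⟨fun ha => ?_, fun ha => ?_, fun ha hb1 => ?_⟩
  · have ha0 : 0 < (h.a (A ⊠ K)).toReal := ENNReal.toReal_pos (hM.a_pos _).ne' ha
    refine powerBound_le ha0 hb ?_ hK hc hγ hμ hx fun m => ?_
    · have h1 := hM.one_lt (A ⊠ K)
      rw [← ENNReal.ofReal_toReal ha, ← ENNReal.ofReal_add ha0.le hb.le, ← ENNReal.ofReal_one,
        ENNReal.ofReal_lt_ofReal_iff (by positivity)] at h1
      exact h1
    · have h1 := hm m
      rwa [HolderData.growth, if_neg ha] at h1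
  · refine logBound_le hb (hM.a'_add_b_pos _ ha) hK hc hγ hμ hx fun m => ?_
    have h1 := hm m
    rwa [HolderData.growth, if_pos ha] at h1
  · refine linearBound_le hK hc hγ hμ hx fun m => ?_
    have h1 := hm m
    rwa [HolderData.growth, if_neg (by rw [ha]; exact ENNReal.one_ne_top), ha, hb1,
      ENNReal.toReal_one, Real.rpow_one, Real.rpow_one] at h1

end Cost

end

/-! ### The theorem. -/

theorem theorem1 {E : Type*} {d : E → ℕ+} (𝓕 : FreeSets d) (M : ∀ S : Sys d, Op S → ℝ)
    (h : HolderData d) (hM : IsResourceMeasure 𝓕 M h)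
    (A A' K : Sys d) (κ : OrthonormalBasis (Fin 2) ℂ (EuclideanSpace ℂ K.idx))
    (Λ : Op A →ₗ[ℂ] Op A') (hΛ : IsChannel Λ)
    (ρ : Fin 2 → Op A) (hρ : ∀ k, IsState (ρ k)) (horth : fidelity (ρ 0) (ρ 1) = 0)
    (p : ℝ) (hp : p ∈ Set.Icc (0 : ℝ) 1) :
    -- bounds on the zero-error cost
    (h.a (A ⊠ K) ≠ ∞ →
      powerBound (h.a (A ⊠ K)).toReal (h.b (A ⊠ K)) (h.K (A ⊠ K)) h.cmax
        (gap M A A' K κ (⇑Λ) p ρ) (irreversibility Λ p ρ) ≤ implCost 𝓕 M A A' (⇑Λ) 0) ∧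
    (h.a (A ⊠ K) = ∞ →
      logBound (h.a' (A ⊠ K)) (h.b (A ⊠ K)) (h.K (A ⊠ K)) h.cmax
        (gap M A A' K κ (⇑Λ) p ρ) (irreversibility Λ p ρ) ≤ implCost 𝓕 M A A' (⇑Λ) 0) ∧
    (h.a (A ⊠ K) = 1 → h.b (A ⊠ K) = 1 →
      linearBound (h.K (A ⊠ K)) h.cmax
        (gap M A A' K κ (⇑Λ) p ρ) (irreversibility Λ p ρ) ≤ implCost 𝓕 M A A' (⇑Λ) 0) ∧
    -- cost divergence, and bounds on the cost with error `ε`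
    (0 < gap M A A' K κ (⇑Λ) p ρ → irreversibility Λ p ρ = 0 →
      implCost 𝓕 M A A' (⇑Λ) 0 = ⊤ ∧
      ∀ ε : ℝ, 0 ≤ ε →
        (h.a (A ⊠ K) ≠ ∞ →
          powerBound (h.a (A ⊠ K)).toReal (h.b (A ⊠ K)) (h.K (A ⊠ K)) h.cmax
            (gap M A A' K κ (⇑Λ) p ρ) ε ≤ implCost 𝓕 M A A' (⇑Λ) ε) ∧
        (h.a (A ⊠ K) = ∞ →
          logBound (h.a' (A ⊠ K)) (h.b (A ⊠ K)) (h.K (A ⊠ K)) h.cmax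
            (gap M A A' K κ (⇑Λ) p ρ) ε ≤ implCost 𝓕 M A A' (⇑Λ) ε) ∧
        (h.a (A ⊠ K) = 1 → h.b (A ⊠ K) = 1 →
          linearBound (h.K (A ⊠ K)) h.cmax
            (gap M A A' K κ (⇑Λ) p ρ) ε ≤ implCost 𝓕 M A A' (⇑Λ) ε)) := by
  have zero_error : ∀ (B B' : Sys d) (η : Op B) (V : Matrix (A' ⊠ B').idx (A ⊠ B).idx ℂ),
      IsState η → V ∈ 𝓕.freeUnitary (A ⊠ B) (A' ⊠ B') → channelDist Λ (implemented η V) ≤ 0 →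
      ∀ (P : Fin 2 → Op A) (Q : Fin 2 → Op A'), IsPVM P → (∀ k, (P k * ρ k).trace = 1) →
      IsPOVM Q → (∀ Q' : Fin 2 → Op A', IsPOVM Q' →
        failProb p (fun k => Λ (ρ k)) Q ≤ failProb p (fun k => Λ (ρ k)) Q') →
      failProb p (fun k => implemented η V (ρ k)) Q ≤ irreversibility Λ p ρ ^ 2 := by
    intro B B' η V hη hV hdist P Q hP hPρ hQ hopt
    have e : (fun k => implemented η V (ρ k)) = fun k => Λ (ρ k) := funext fun k =>
      (eq_of_channelDist_le_zero hΛ.isPositiveTP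
        (isPositiveTP_implemented hη (𝓕.isUnitary _ _ V hV).1) hdist (hρ k)).symm
    rw [e]
    exact failProb_le_irreversibility_sq hΛ hρ hp hP hPρ hopt
  have hδ : 0 ≤ irreversibility Λ p ρ := Real.sqrt_nonneg _
  refine ⟨fun ha => le_sInf ?_, fun ha => le_sInf ?_, fun ha hb => le_sInf ?_,
    fun hG h0 => ⟨?_, fun ε hε => ?_⟩⟩
  · rintro _ ⟨B, B', η, V, hη, hV, hd, rfl⟩
    exact (hM.bounds_le hV hη hδ (zero_error B B' η V hη hV hd)).1 ha
  · rintro _ ⟨B, B', η, V, hη, hV, hd, rfl⟩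
    exact (hM.bounds_le hV hη hδ (zero_error B B' η V hη hV hd)).2.1 ha
  · rintro _ ⟨B, B', η, V, hη, hV, hd, rfl⟩
    exact (hM.bounds_le hV hη hδ (zero_error B B' η V hη hV hd)).2.2 ha hb
  · refine sInf_eq_top.2 ?_
    rintro _ ⟨B, B', η, V, hη, hV, hd, rfl⟩
    obtain ⟨htop, hm⟩ := hM.gap_le (κ := κ) hV hη hδ (zero_error B B' η V hη hV hd)
    refine (false_of_forall_nat_mul_le (ENNReal.toReal_pos hG.ne' htop)
      (μ := M B η + h.cmax) fun m => ?_).elim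
    have h1 := hm m
    -- As b > 0, δ = 0 removes the Hölder term, and m G stays bounded for all m.
    rwa [h0, mul_zero, mul_zero, Real.zero_rpow (hM.b_pos _).ne', mul_zero, add_zero] at h1
  · have approx : ∀ (B B' : Sys d) (η : Op B) (V : Matrix (A' ⊠ B').idx (A ⊠ B).idx ℂ),
        IsState η → V ∈ 𝓕.freeUnitary (A ⊠ B) (A' ⊠ B') →
        channelDist Λ (implemented η V) ≤ ε →
        ∀ (P : Fin 2 → Op A) (Q : Fin 2 → Op A'), IsPVM P → (∀ k, (P k * ρ k).trace = 1) →
        IsPOVM Q → (∀ Q' : Fin 2 → Op A', IsPOVM Q' →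
          failProb p (fun k => Λ (ρ k)) Q ≤ failProb p (fun k => Λ (ρ k)) Q') →
        failProb p (fun k => implemented η V (ρ k)) Q ≤ ε ^ 2 := by
      intro B B' η V hη hV hdist P Q hP hPρ hQ hopt
      refine failProb_le_of_channelDist_le hΛ.isPositiveTP
        (isPositiveTP_implemented hη (𝓕.isUnitary _ _ V hV).1) hdist hρ hp hQ ?_
      -- δ = 0 makes every optimal Q perfect for the exact channel.
      have h1 := failProb_le_irreversibility_sq hΛ hρ hp hP hPρ hopt
      rwa [h0, zero_pow two_ne_zero] at h1
    refine ⟨fun ha => le_sInf ?_, fun ha => le_sInf ?_, fun ha hb => le_sInf ?_⟩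
    · rintro _ ⟨B, B', η, V, hη, hV, hd, rfl⟩
      exact (hM.bounds_le hV hη hε (approx B B' η V hη hV hd)).1 ha
    · rintro _ ⟨B, B', η, V, hη, hV, hd, rfl⟩
      exact (hM.bounds_le hV hη hε (approx B B' η V hη hV hd)).2.1 ha
    · rintro _ ⟨B, B', η, V, hη, hV, hd, rfl⟩
      exact (hM.bounds_le hV hη hε (approx B B' η V hη hV hd)).2.2 ha hb
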